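/- Let $N\ge 1$ and $p\in[1,\infty]$. There is a constant $C=C(p,N)>0$, depending only on $p$ and $N$, such that the following holds for every constant vector $a\in\mathbb{R}^N$, every $F\in C^1(\mathbb{R})$ with $F(0)=0$, and every real-valued $u_0\in L^1(\mathbb{R}^N)\cap L^\infty(\mathbb{R}^N)$. If $u\in C([0,\infty);L^1(\mathbb{R}^N))\cap L^\infty(\mathbb{R}^N\times(0,\infty))$ is a solution of $$u_t-\Delta u=a\cdot\nabla\bigl(F(u)\bigr)\ \text{ in }\mathbb{R}^N\times(0,\infty),\qquad u(0)=u_0,$$ that is, $u(0)=u_0$ in $L^1(\mathbb{R}^N)$ and $$\int_0^\infty\!\!\int_{\mathbb{R}^N}u\,(\varphi_t+\Delta\varphi)\,dx\,dt=\int_0^\infty\!\!\int_{\mathbb{R}^N}F(u)\,a\cdot\nabla\varphi\,dx\,dt\qquad\text{for all }\varphi\in C_c^\infty(\mathbb{R}^N\times(0,\infty)),$$ then $$\|u(t)\|_p\le C\,\|u_0\|_1\,t^{-\frac N2\left(1-\frac1p\right)}\qquad\text{for all }t>0.$$ -/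

import Mathlib

open MeasureTheory Filter Set
open scoped Topology ENNReal ContDiff

/-- The test functions `φ ∈ C_c^∞((0, ∞) × ℝᴺ)`: smooth real functions of time and space with compact
support contained in the open half space `t > 0`. -/
structure IsParabolicTest {N : ℕ} (φ : ℝ → EuclideanSpace ℝ (Fin N) → ℝ) : Prop where
  smooth : ContDiff ℝ ∞ (Function.uncurry φ)
  compact_support : HasCompactSupport (Function.uncurry φ)
  support_pos : tsupport (Function.uncurry φ) ⊆ Ioi 0 ×ˢ univ

/-- `u` is a solution of the Cauchy problem
`u_t - Δu = a · ∇(F(u))` in `ℝᴺ × (0, ∞)`, `u(0) = u₀`,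
in the class `C([0, ∞); L¹(ℝᴺ)) ∩ L^∞(ℝᴺ × (0, ∞))`. Here `u t x` is the value at time `t` and
position `x`; only times `t ≥ 0` matter. The equation holds in the sense of distributions on
`(0, ∞) × ℝᴺ`, and the initial datum is attained through the continuity in `L¹` at `t = 0`. -/
structure IsConvectionDiffusionSolution {N : ℕ} (a : EuclideanSpace ℝ (Fin N)) (F : ℝ → ℝ)
    (u₀ : EuclideanSpace ℝ (Fin N) → ℝ) (u : ℝ → EuclideanSpace ℝ (Fin N) → ℝ) : Prop where
  /-- `u(t) ∈ L¹(ℝᴺ)` for all `t ≥ 0`. -/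
  memLp_one : ∀ t : ℝ, 0 ≤ t → MemLp (u t) 1 volume
  /-- `t ↦ u(t)` is continuous from `[0, ∞)` to `L¹(ℝᴺ)`. -/
  continuous_L1 : ∀ t : ℝ, 0 ≤ t →
    Tendsto (fun s : ℝ => eLpNorm (u s - u t) 1 volume) (𝓝[Ici 0] t) (𝓝 0)
  /-- `u ∈ L^∞(ℝᴺ × (0, ∞))`. -/
  memLp_top : MemLp (Function.uncurry u) ⊤ (volume.restrict (Ioi (0 : ℝ) ×ˢ univ))
  /-- `u(0) = u₀`. -/
  initial : u 0 =ᵐ[volume] u₀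
  /-- The equation, tested against `φ` (all derivatives are moved to `φ`; `fderiv ℝ (φ t) x a` is
  `a · ∇φ(t, x)`). -/
  equation : ∀ φ : ℝ → EuclideanSpace ℝ (Fin N) → ℝ, IsParabolicTest φ →
    ∫ t in Ioi (0 : ℝ), ∫ x, u t x *
        (deriv (fun s => φ s x) t + Laplacian.laplacian (φ t) x) =
      ∫ t in Ioi (0 : ℝ), ∫ x, F (u t x) * fderiv ℝ (φ t) x a

/-!
The transport term is a total derivative: for a convex entropy `J` the product `J''(u) F(u) a·∇u`
is the derivative along `a` of a function of `u`, so it disappears from the balance of `∫ J(u)` and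
only the heat dissipation is left. All decay estimates are therefore those of the heat equation,
with constants that see neither `a` nor `F`.

Since `u` is only a bounded distributional solution, the balance is written for the mollified
function `k ∗ u`, which solves the equation up to the commutator `k ∗ F(u) - F(k ∗ u)`. Its
contribution is split by Young's inequality into half of the dissipation and a multiple of the
squared `L²` norm of the commutator; the latter tends to `0` as `k` concentrates at the origin,
because `u` is bounded and `F` is Lipschitz on its range.

With `J(s) = √(s² + η²) - η` and `η → 0` the balance gives the contraction `‖u(t)‖₁ ≤ ‖u₀‖₁`. With
`J(s) = s ^ (2n + 2)`, a power of `t` as weight, and Nash's inequality for `u ^ (n + 1)` on the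
length scale `√t`, a decay estimate for the moment of order `n + 1` gives one for the order
`2n + 2`. Starting from `n = 0` this iteration reaches `L^∞`, and `1 < p < ∞` follows by
interpolation.
-/

/-- Smooth, compactly supported real functions. -/
structure IsTestFunction {E : Type*} [NormedAddCommGroup E] [NormedSpace ℝ E] (k : E → ℝ) :
    Prop where
  contDiff : ContDiff ℝ ∞ k
  hasCompactSupport : HasCompactSupport k

/-- The mollification `k ∗ f` of a function `f` by a kernel `k`. -/
noncomputable def mollify {E : Type*} [NormedAddCommGroup E] [MeasureSpace E] (k f : E → ℝ) :
    E → ℝ :=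
  convolution f k (ContinuousLinearMap.mul ℝ ℝ) volume

/-- Mollifiers: nonnegative smooth compactly supported kernels of unit mass. -/
structure IsMollifier {E : Type*} [NormedAddCommGroup E] [NormedSpace ℝ E] [MeasureSpace E]
    (k : E → ℝ) : Prop extends IsTestFunction k where
  nonneg : ∀ x, 0 ≤ k x
  integral_eq_one : ∫ x, k x = 1

namespace IsTestFunction

variable {E : Type*} [NormedAddCommGroup E] [NormedSpace ℝ E] {k : E → ℝ}

theorem continuous (hk : IsTestFunction k) : Continuous k := hk.contDiff.continuous

theorem differentiable (hk : IsTestFunction k) : Differentiable ℝ k :=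
  hk.contDiff.differentiable (by simp)

theorem fderiv_apply (hk : IsTestFunction k) (e : E) :
    IsTestFunction fun x => fderiv ℝ k x e where
  contDiff := (hk.contDiff.fderiv_right (m := ∞) (by simp)).clm_apply contDiff_const
  hasCompactSupport := (hk.hasCompactSupport.fderiv ℝ).comp_left
    (g := fun l : E →L[ℝ] ℝ => l e) (by simp)

theorem exists_abs_le (hk : IsTestFunction k) : ∃ B, 0 ≤ B ∧ ∀ x, |k x| ≤ B := by
  obtain ⟨B, hB⟩ := hk.hasCompactSupport.exists_bound_of_continuous hk.continuous
  exact ⟨B, (norm_nonneg _).trans (hB 0), hB⟩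

end IsTestFunction

/-- Smooth bumps around the origin of outer radius `1 / (n + 1)`; normalised, they form an
approximate identity. -/
noncomputable def shrinkingBump {E : Type*} [NormedAddCommGroup E] (n : ℕ) :
    ContDiffBump (0 : E) where
  rIn := 1 / (n + 1 : ℝ) / 2
  rOut := 1 / (n + 1 : ℝ)
  rIn_pos := by positivity
  rIn_lt_rOut := half_lt_self (by positivity)

theorem tendsto_rOut_shrinkingBump {E : Type*} [NormedAddCommGroup E] :
    Tendsto (fun n => (shrinkingBump (E := E) n).rOut) atTop (𝓝 0) :=
  tendsto_one_div_add_atTop_nhds_zero_nat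

section Mollification

variable {E : Type*} [NormedAddCommGroup E] [InnerProductSpace ℝ E] [FiniteDimensional ℝ E]
  [MeasurableSpace E] [BorelSpace E] {k f g : E → ℝ}

theorem mollify_apply (k f : E → ℝ) (x : E) : mollify k f x = ∫ y, f y * k (x - y) := rfl

theorem mollify_apply_swap (k f : E → ℝ) (x : E) : mollify k f x = ∫ y, f (x - y) * k y := by
  rw [mollify_apply, ← integral_sub_left_eq_self (fun y => f y * k (x - y)) volume x]
  simp only [sub_sub_cancel]

namespace IsTestFunction

theorem integrable (hk : IsTestFunction k) : Integrable k :=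
  hk.continuous.integrable_of_hasCompactSupport hk.hasCompactSupport

theorem integrable_mul_sub (hk : IsTestFunction k) (hf : Integrable f) (x : E) :
    Integrable fun y => f y * k (x - y) := by
  obtain ⟨B, -, hB⟩ := hk.exists_abs_le
  exact hf.mul_bdd (hk.continuous.comp (continuous_sub_left x)).aestronglyMeasurable
    (Eventually.of_forall fun y => hB _)

theorem mollify_sub (hk : IsTestFunction k) (hf : Integrable f) (hg : Integrable g) (x : E) :
    mollify k (fun y => f y - g y) x = mollify k f x - mollify k g x := by
  simp only [mollify_apply, sub_mul]
  exact integral_sub (hk.integrable_mul_sub hf x) (hk.integrable_mul_sub hg x)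

theorem contDiff_mollify (hk : IsTestFunction k) (hf : Integrable f) :
    ContDiff ℝ ∞ (mollify k f) :=
  hk.hasCompactSupport.contDiff_convolution_right (ContinuousLinearMap.mul ℝ ℝ)
    hf.locallyIntegrable hk.contDiff

theorem differentiable_mollify (hk : IsTestFunction k) (hf : Integrable f) :
    Differentiable ℝ (mollify k f) :=
  (hk.contDiff_mollify hf).differentiable (by simp)

theorem continuous_mollify (hk : IsTestFunction k) (hf : Integrable f) :
    Continuous (mollify k f) :=
  (hk.contDiff_mollify hf).continuous

theorem fderiv_mollify_apply (hk : IsTestFunction k) (hf : Integrable f) (x e : E) :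
    fderiv ℝ (mollify k f) x e = mollify (fun z => fderiv ℝ k z e) f x := by
  have hderiv := hk.hasCompactSupport.hasFDerivAt_convolution_right
    (ContinuousLinearMap.mul ℝ ℝ) hf.locallyIntegrable (hk.contDiff.of_le (by simp)) x
    (μ := volume)
  rw [mollify, hderiv.fderiv, convolution_precompR_apply _ hf.locallyIntegrable
    (hk.hasCompactSupport.fderiv ℝ) (hk.contDiff.continuous_fderiv (by simp))]
  rfl

theorem integrable_mollify (hk : IsTestFunction k) (hf : Integrable f) :
    Integrable (mollify k f) :=
  hf.integrable_convolution (ContinuousLinearMap.mul ℝ ℝ) hk.integrable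

theorem integral_mollify (hk : IsTestFunction k) (hf : Integrable f) :
    ∫ x, mollify k f x = (∫ x, f x) * ∫ x, k x :=
  integral_convolution (ContinuousLinearMap.mul ℝ ℝ) hf hk.integrable

theorem integral_abs_mollify_le (hk : IsTestFunction k) (hf : Integrable f) :
    ∫ x, |mollify k f x| ≤ (∫ x, |f x|) * ∫ x, |k x| := by
  calc ∫ x, |mollify k f x| ≤ ∫ x, mollify (|k ·|) (|f ·|) x := by
        refine integral_mono (hk.integrable_mollify hf).abs
          (hf.abs.integrable_convolution (ContinuousLinearMap.mul ℝ ℝ) hk.integrable.abs)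
          fun x => abs_integral_le_integral_abs.trans_eq ?_
        simp only [mollify_apply, ContinuousLinearMap.mul_apply', abs_mul]
    _ = (∫ x, |f x|) * ∫ x, |k x| :=
        integral_convolution (ContinuousLinearMap.mul ℝ ℝ) hf.abs hk.integrable.abs

theorem abs_mollify_le (hk : IsTestFunction k) {M : ℝ} (hM : ∀ x, |f x| ≤ M) (x : E) :
    |mollify k f x| ≤ M * ∫ y, |k y| := by
  rw [← integral_const_mul, ← integral_sub_left_eq_self _ volume x, mollify_apply,
    ← Real.norm_eq_abs]
  refine norm_integral_le_of_norm_le ((hk.integrable.abs.comp_sub_left x).const_mul M)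
    (Eventually.of_forall fun y => ?_)
  rw [Real.norm_eq_abs, abs_mul]
  exact mul_le_mul_of_nonneg_right (hM y) (abs_nonneg _)

end IsTestFunction

theorem abs_mollify_le_mul_integral_abs {B : ℝ} (hB : ∀ x, |k x| ≤ B) (hf : Integrable f)
    (x : E) : |mollify k f x| ≤ B * ∫ y, |f y| := by
  rw [← integral_const_mul, mollify_apply, ← Real.norm_eq_abs]
  refine norm_integral_le_of_norm_le (hf.abs.const_mul B) (Eventually.of_forall fun y => ?_)
  rw [Real.norm_eq_abs, abs_mul, mul_comm]
  exact mul_le_mul_of_nonneg_right (hB _) (abs_nonneg _)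

theorem tendsto_integral_abs_sub_translate (hf : Integrable f) :
    Tendsto (fun y => ∫ x, |f (x - y) - f x|) (𝓝 0) (𝓝 0) := by
  have hf1 : MemLp f 1 volume := memLp_one_iff_integrable.2 hf
  have : Fact ((1 : ℝ≥0∞) ≠ ⊤) := ⟨ENNReal.one_ne_top⟩
  have hcont : Continuous fun y : E => DomAddAct.mk (-y) +ᵥ hf1.toLp f :=
    (DomAddAct.continuous_mk.comp continuous_neg).vadd continuous_const
  refine (tendsto_iff_dist_tendsto_zero.1 (hcont.tendsto 0)).congr fun y => ?_
  simp only [DomAddAct.mk_vadd_toLp]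
  rw [dist_eq_norm, ← MemLp.toLp_sub, L1.norm_eq_integral_norm]
  refine integral_congr_ae ?_
  filter_upwards [MemLp.coeFn_toLp (MemLp.sub (hf1.comp_measurePreserving
    (measurePreserving_vadd (-y) volume)) (hf1.comp_measurePreserving
    (measurePreserving_vadd (-(0 : E)) volume)))] with x hx
  refine (congrArg norm hx).trans ?_
  simp [neg_add_eq_sub]

namespace IsMollifier

theorem integral_sub_left (hk : IsMollifier k) (x : E) : ∫ y, k (x - y) = 1 := by
  rw [integral_sub_left_eq_self k volume x, hk.integral_eq_one]

theorem integrable_sub_left (hk : IsMollifier k) (x : E) : Integrable fun y => k (x - y) :=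
  hk.integrable.comp_sub_left x

theorem integral_abs (hk : IsMollifier k) : ∫ x, |k x| = 1 := by
  simp only [abs_of_nonneg (hk.nonneg _), hk.integral_eq_one]

theorem abs_mollify_le (hk : IsMollifier k) {M : ℝ} (hM : ∀ x, |f x| ≤ M) (x : E) :
    |mollify k f x| ≤ M := by
  simpa only [hk.integral_abs, mul_one] using hk.toIsTestFunction.abs_mollify_le hM x

theorem integral_mollify (hk : IsMollifier k) (hf : Integrable f) :
    ∫ x, mollify k f x = ∫ x, f x := by
  rw [hk.toIsTestFunction.integral_mollify hf, hk.integral_eq_one, mul_one]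

theorem integral_abs_mollify_le (hk : IsMollifier k) (hf : Integrable f) :
    ∫ x, |mollify k f x| ≤ ∫ x, |f x| := by
  simpa only [hk.integral_abs, mul_one] using hk.toIsTestFunction.integral_abs_mollify_le hf

theorem exists_isProbabilityMeasure_mollify_eq (hk : IsMollifier k) (x : E) :
    ∃ μ : Measure E, IsProbabilityMeasure μ ∧ (∀ h : E → ℝ, Integrable h → Integrable h μ) ∧
      ∀ h : E → ℝ, mollify k h x = ∫ y, h y ∂μ := by
  have hmeas : Measurable fun y => (k (x - y)).toNNReal :=
    (hk.continuous.comp (continuous_sub_left x)).measurable.real_toNNReal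
  have hcoe (y : E) : ((k (x - y)).toNNReal : ℝ) = k (x - y) := Real.coe_toNNReal _ (hk.nonneg _)
  refine ⟨volume.withDensity fun y => ((k (x - y)).toNNReal : ℝ≥0∞), ⟨?_⟩, fun h hh => ?_,
    fun h => ?_⟩
  · have hmass := ofReal_integral_eq_lintegral_ofReal (hk.integrable_sub_left x)
      (Eventually.of_forall fun y => hk.nonneg _)
    rw [hk.integral_sub_left, ENNReal.ofReal_one] at hmass
    rw [withDensity_apply _ MeasurableSet.univ, Measure.restrict_univ]
    exact hmass.symm
  · rw [integrable_withDensity_iff_integrable_coe_smul hmeas]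
    simpa only [hcoe, smul_eq_mul, mul_comm] using hk.integrable_mul_sub hh x
  · simp only [integral_withDensity_eq_integral_smul hmeas, mollify_apply, NNReal.smul_def, hcoe,
      smul_eq_mul, mul_comm]

theorem comp_mollify_le (hk : IsMollifier k) {Φ : ℝ → ℝ} (hΦ : ConvexOn ℝ univ Φ)
    (hf : Integrable f) (hΦf : Integrable fun y => Φ (f y)) (x : E) :
    Φ (mollify k f x) ≤ mollify k (fun y => Φ (f y)) x := by
  obtain ⟨μ, _, hint, hmollify⟩ := hk.exists_isProbabilityMeasure_mollify_eq x
  rw [hmollify, hmollify]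
  exact hΦ.map_integral_le (hΦ.continuousOn isOpen_univ) isClosed_univ
    (Eventually.of_forall fun _ => mem_univ _) (hint f hf) (hint _ hΦf)

theorem integral_comp_mollify_le (hk : IsMollifier k) {Φ : ℝ → ℝ} (hΦ : ConvexOn ℝ univ Φ)
    (hf : Integrable f) (hΦf : Integrable fun x => Φ (f x))
    (hΦm : Integrable fun x => Φ (mollify k f x)) :
    ∫ x, Φ (mollify k f x) ≤ ∫ x, Φ (f x) :=
  (integral_mono hΦm (hk.integrable_mollify hΦf) (hk.comp_mollify_le hΦ hf hΦf)).trans_eq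
    (hk.integral_mollify hΦf)

theorem integral_abs_mollify_sub_le (hk : IsMollifier k) (hf : Integrable f) {r δ : ℝ}
    (hr : ∀ x, k x ≠ 0 → ‖x‖ < r) (hδ : ∀ y, ‖y‖ < r → ∫ x, |f (x - y) - f x| ≤ δ) :
    ∫ x, |mollify k f x - f x| ≤ δ := by
  have hpointwise (x : E) : |mollify k f x - f x| ≤ ∫ y, |f (x - y) - f x| * k y := by
    have hi : Integrable fun y => f (x - y) * k y := by
      simpa only [sub_sub_cancel] using (hk.integrable_mul_sub hf x).comp_sub_left x
    have heq : mollify k f x - f x = ∫ y, (f (x - y) - f x) * k y := by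
      simp only [sub_mul]
      rw [integral_sub hi (hk.integrable.const_mul _), integral_const_mul, hk.integral_eq_one,
        mollify_apply_swap, mul_one]
    rw [heq]
    refine abs_integral_le_integral_abs.trans_eq ?_
    simp only [abs_mul, abs_of_nonneg (hk.nonneg _)]
  have hprod : Integrable (fun p : E × E => |f (p.1 - p.2) - f p.1| * k p.2)
      (volume.prod volume) := by
    have htranslate : Integrable (fun p : E × E => f (p.1 - p.2) * k p.2) (volume.prod volume) :=
      (hk.integrable.convolution_integrand (ContinuousLinearMap.mul ℝ ℝ) hf).congr
        (Eventually.of_forall fun p => mul_comm _ _)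
    refine (htranslate.sub (hf.mul_prod hk.integrable)).norm.congr
      (Eventually.of_forall fun p => ?_)
    simp only [Pi.sub_apply, ← sub_mul, norm_mul, Real.norm_eq_abs, abs_of_nonneg (hk.nonneg _)]
  calc ∫ x, |mollify k f x - f x| ≤ ∫ x, ∫ y, |f (x - y) - f x| * k y :=
        integral_mono ((hk.integrable_mollify hf).sub hf).abs hprod.integral_prod_left hpointwise
    _ = ∫ y, (∫ x, |f (x - y) - f x|) * k y := by
        rw [integral_integral_swap hprod]
        simp only [integral_mul_const]
    _ ≤ ∫ y, δ * k y := by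
        refine integral_mono ?_ (hk.integrable.const_mul _) fun y => ?_
        · simpa only [integral_mul_const] using hprod.integral_prod_right
        · by_cases hy : k y = 0
          · simp only [hy, mul_zero, le_refl]
          · exact mul_le_mul_of_nonneg_right (hδ y (hr y hy)) (hk.nonneg y)
    _ = δ := by rw [integral_const_mul, hk.integral_eq_one, mul_one]

end IsMollifier

variable (E) in
theorem exists_isMollifier_tendsto :
    ∃ k : ℕ → E → ℝ, (∀ n, IsMollifier (k n)) ∧ ∀ f : E → ℝ, Integrable f →
      Tendsto (fun n => ∫ x, |mollify (k n) f x - f x|) atTop (𝓝 0) := by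
  let φ := shrinkingBump (E := E)
  have hφ (n : ℕ) : IsMollifier ((φ n).normed volume) :=
    ⟨⟨(φ n).contDiff_normed, (φ n).hasCompactSupport_normed⟩, (φ n).nonneg_normed,
      (φ n).integral_normed⟩
  refine ⟨fun n => (φ n).normed volume, hφ, fun f hf => tendsto_order.2
    ⟨fun a ha => Eventually.of_forall fun n => ha.trans_le (by positivity), fun ε hε => ?_⟩⟩
  obtain ⟨r, hr, htranslate⟩ := Metric.eventually_nhds_iff_ball.1
    ((tendsto_integral_abs_sub_translate hf).eventually_lt_const (half_pos hε))
  filter_upwards [(tendsto_rOut_shrinkingBump (E := E)).eventually_lt_const hr] with n hn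
  refine ((hφ n).integral_abs_mollify_sub_le hf (r := r) (fun x hx => ?_) fun y hy =>
    (htranslate y (mem_ball_zero_iff.2 hy)).le).trans_lt (half_lt_self hε)
  have hsupp : x ∈ Function.support ((φ n).normed volume) := hx
  rw [(φ n).support_normed_eq, mem_ball_zero_iff] at hsupp
  exact hsupp.trans hn

end Mollification

section Nash

theorem sq_integral_le_integral_sq {g : ℝ → ℝ} (hg : Continuous g) :
    (∫ s in (0 : ℝ)..1, g s) ^ 2 ≤ ∫ s in (0 : ℝ)..1, g s ^ 2 := by
  have : IsProbabilityMeasure (volume.restrict (Ioc (0 : ℝ) 1)) := ⟨by simp⟩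
  simp only [intervalIntegral.integral_of_le zero_le_one]
  exact even_two.convexOn_pow.map_integral_le (continuous_pow 2).continuousOn isClosed_univ
    (Eventually.of_forall fun _ => mem_univ _) (hg.integrableOn_Ioc)
    ((hg.pow 2).integrableOn_Ioc)

variable {E : Type*} [NormedAddCommGroup E] [InnerProductSpace ℝ E] {V : E → ℝ}

theorem sq_translate_sub_le (hV : ContDiff ℝ 1 V) (x y : E) :
    (V (x + y) - V x) ^ 2 ≤ ∫ s in (0 : ℝ)..1, ‖y‖ ^ 2 * ‖fderiv ℝ V (x + s • y)‖ ^ 2 := by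
  have hline (s : ℝ) : HasDerivAt (fun s : ℝ => x + s • y) y s := by
    simpa only [one_smul, id_eq] using ((hasDerivAt_id s).smul_const y).const_add x
  have hderiv (s : ℝ) : HasDerivAt (fun s : ℝ => V (x + s • y)) (fderiv ℝ V (x + s • y) y) s :=
    (hV.differentiable one_ne_zero _).hasFDerivAt.comp_hasDerivAt s (hline s)
  have hgrad : Continuous fun s : ℝ => fderiv ℝ V (x + s • y) :=
    (hV.continuous_fderiv one_ne_zero).comp (by fun_prop)
  have hcont : Continuous fun s : ℝ => fderiv ℝ V (x + s • y) y := hgrad.clm_apply continuous_const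
  have hFTC : V (x + y) - V x = ∫ s in (0 : ℝ)..1, fderiv ℝ V (x + s • y) y := by
    simpa only [one_smul, zero_smul, add_zero] using
      (intervalIntegral.integral_eq_sub_of_hasDerivAt (fun s _ => hderiv s)
        (hcont.intervalIntegrable 0 1)).symm
  rw [hFTC]
  refine (sq_integral_le_integral_sq hcont).trans
    (intervalIntegral.integral_mono_on zero_le_one ((hcont.pow 2).intervalIntegrable _ _)
      ((continuous_const.mul (hgrad.norm.pow 2)).intervalIntegrable _ _) fun s _ => ?_)
  rw [← mul_pow, ← sq_abs, mul_comm]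
  exact pow_le_pow_left₀ (abs_nonneg _) ((fderiv ℝ V (x + s • y)).le_opNorm y) 2

variable [FiniteDimensional ℝ E] [MeasurableSpace E] [BorelSpace E]

theorem integrable_prod_comp_add_smul {G : E → ℝ} (hGc : Continuous G) (hG : Integrable G)
    (y : E) : Integrable (fun p : E × ℝ => G (p.1 + p.2 • y))
      (volume.prod (volume.restrict (Ioc (0 : ℝ) 1))) := by
  have hc : Continuous fun p : E × ℝ => G (p.1 + p.2 • y) := hGc.comp (by fun_prop)
  refine (integrable_prod_iff' hc.aestronglyMeasurable).2
    ⟨Eventually.of_forall fun s => hG.comp_add_right (s • y), ?_⟩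
  have hnorm (s : ℝ) : ∫ x, ‖G (x + s • y)‖ = ∫ x, ‖G x‖ :=
    integral_add_right_eq_self (fun x => ‖G x‖) (s • y)
  simp only [hnorm]
  exact integrable_const _

theorem integral_sq_translate_sub_le (hV : ContDiff ℝ 1 V)
    (hgrad : Integrable fun x => ‖fderiv ℝ V x‖ ^ 2) (y : E) :
    Integrable (fun x => (V (x + y) - V x) ^ 2) ∧
      ∫ x, (V (x + y) - V x) ^ 2 ≤ ‖y‖ ^ 2 * ∫ x, ‖fderiv ℝ V x‖ ^ 2 := by
  have hc : Continuous fun x => (V (x + y) - V x) ^ 2 := by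
    have := hV.continuous
    fun_prop
  have hprod := (integrable_prod_comp_add_smul ((hV.continuous_fderiv one_ne_zero).norm.pow 2)
    hgrad y).const_mul (‖y‖ ^ 2)
  have hle (x : E) : (V (x + y) - V x) ^ 2 ≤
      ∫ s in Ioc (0 : ℝ) 1, ‖y‖ ^ 2 * ‖fderiv ℝ V (x + s • y)‖ ^ 2 := by
    simpa only [intervalIntegral.integral_of_le zero_le_one] using sq_translate_sub_le hV x y
  have hint : Integrable fun x => (V (x + y) - V x) ^ 2 :=
    hprod.integral_prod_left.mono' hc.aestronglyMeasurable
      (Eventually.of_forall fun x => by rw [Real.norm_of_nonneg (sq_nonneg _)]; exact hle x)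
  refine ⟨hint, ?_⟩
  calc ∫ x, (V (x + y) - V x) ^ 2
      ≤ ∫ x, ∫ s in Ioc (0 : ℝ) 1, ‖y‖ ^ 2 * ‖fderiv ℝ V (x + s • y)‖ ^ 2 :=
        integral_mono hint hprod.integral_prod_left hle
    _ = ∫ s in Ioc (0 : ℝ) 1, ∫ x, ‖y‖ ^ 2 * ‖fderiv ℝ V (x + s • y)‖ ^ 2 :=
        integral_integral_swap hprod
    _ = ∫ s in Ioc (0 : ℝ) 1, ‖y‖ ^ 2 * ∫ x, ‖fderiv ℝ V x‖ ^ 2 := by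
        refine integral_congr_ae (Eventually.of_forall fun s => ?_)
        simp only [integral_const_mul]
        rw [integral_add_right_eq_self (fun x => ‖fderiv ℝ V x‖ ^ 2) (s • y)]
    _ = ‖y‖ ^ 2 * ∫ x, ‖fderiv ℝ V x‖ ^ 2 := by simp

theorem integral_sq_le_of_translate (hV : ContDiff ℝ 1 V) (hsq : Integrable fun x => V x ^ 2)
    (hgrad : Integrable fun x => ‖fderiv ℝ V x‖ ^ 2) (y : E) :
    ∫ x, V x ^ 2 ≤ ‖y‖ ^ 2 / 2 * (∫ x, ‖fderiv ℝ V x‖ ^ 2) + ∫ x, |V x| * |V (x + y)| := by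
  obtain ⟨hdiff, hdiff_le⟩ := integral_sq_translate_sub_le hV hgrad y
  have hsq' : Integrable fun x => V (x + y) ^ 2 := hsq.comp_add_right y
  have hmul : Integrable fun x => |V x| * |V (x + y)| := by
    have hc : Continuous fun x => |V x| * |V (x + y)| := by
      have := hV.continuous
      fun_prop
    refine (hsq.add hsq').mono' hc.aestronglyMeasurable (Eventually.of_forall fun x => ?_)
    rw [Real.norm_of_nonneg (by positivity), Pi.add_apply, ← sq_abs (V x), ← sq_abs (V (x + y))]
    nlinarith [sq_nonneg (|V x| - |V (x + y)|), sq_nonneg |V x|, sq_nonneg |V (x + y)|]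
  have hpointwise (x : E) :
      V x ^ 2 + V (x + y) ^ 2 ≤ (V (x + y) - V x) ^ 2 + 2 * (|V x| * |V (x + y)|) := by
    rw [← abs_mul]
    linarith [le_abs_self (V x * V (x + y)), sub_sq (V (x + y)) (V x)]
  have hintegral := integral_mono (hsq.add hsq') (hdiff.add (hmul.const_mul 2)) hpointwise
  rw [integral_add' hsq hsq', integral_add' hdiff (hmul.const_mul 2), integral_const_mul,
    integral_add_right_eq_self (fun x => V x ^ 2) y] at hintegral
  linarith

theorem integrable_prod_abs_mul_abs_add (hVc : Continuous V) (hV : Integrable V) :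
    Integrable (fun p : E × E => |V p.1| * |V (p.1 + p.2)|) (volume.prod volume) := by
  have hc : Continuous fun p : E × E => |V p.1| * |V (p.1 + p.2)| := by fun_prop
  refine (integrable_prod_iff hc.aestronglyMeasurable).2
    ⟨Eventually.of_forall fun x => (hV.abs.comp_add_left x).const_mul |V x|, ?_⟩
  have hnorm (x : E) : ∫ y, ‖|V x| * |V (x + y)|‖ = |V x| * ∫ y, |V y| := by
    simp only [norm_mul, Real.norm_eq_abs, abs_abs]
    rw [integral_const_mul, integral_add_left_eq_self (fun y => |V y|) x]
  simp only [hnorm]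
  exact hV.abs.mul_const _

theorem integral_integral_abs_mul_abs_add (hVc : Continuous V) (hV : Integrable V) :
    ∫ y, ∫ x, |V x| * |V (x + y)| = (∫ x, |V x|) ^ 2 := by
  rw [← integral_integral_swap (integrable_prod_abs_mul_abs_add hVc hV), sq, ← integral_mul_const]
  refine integral_congr_ae (Eventually.of_forall fun x => ?_)
  simp only [integral_const_mul, integral_add_left_eq_self (fun y => |V y|) x]

-- Nash's inequality before optimising in the length scale `r`: average the translation estimate
-- over the ball of radius `r`.
theorem integral_sq_le_of_scale (hV : ContDiff ℝ 1 V) (hi : Integrable V)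
    (hsq : Integrable fun x => V x ^ 2) (hgrad : Integrable fun x => ‖fderiv ℝ V x‖ ^ 2)
    {r : ℝ} (hr : 0 < r) :
    ∫ x, V x ^ 2 ≤ r ^ 2 / 2 * (∫ x, ‖fderiv ℝ V x‖ ^ 2)
      + (∫ x, |V x|) ^ 2 / volume.real (Metric.ball (0 : E) r) := by
  set D := ∫ x, ‖fderiv ℝ V x‖ ^ 2
  set vol := volume.real (Metric.ball (0 : E) r)
  have hvol : 0 < vol := ENNReal.toReal_pos (Metric.measure_ball_pos _ _ hr).ne'
    measure_ball_lt_top.ne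
  have hconst (c : ℝ) : IntegrableOn (fun _ : E => c) (Metric.ball 0 r) :=
    integrableOn_const measure_ball_lt_top.ne
  have hcross : Integrable fun y => ∫ x, |V x| * |V (x + y)| :=
    (integrable_prod_abs_mul_abs_add hV.continuous hi).integral_prod_right
  have hball : ∀ y ∈ Metric.ball (0 : E) r,
      ∫ x, V x ^ 2 ≤ r ^ 2 / 2 * D + ∫ x, |V x| * |V (x + y)| := fun y hy => by
    have hyr : ‖y‖ ≤ r := (mem_ball_zero_iff.1 hy).le
    have hD : 0 ≤ D := integral_nonneg fun x => sq_nonneg _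
    exact (integral_sq_le_of_translate hV hsq hgrad y).trans
      (add_le_add_left (mul_le_mul_of_nonneg_right (by gcongr) hD) _)
  have havg : (∫ x, V x ^ 2) * vol ≤ r ^ 2 / 2 * D * vol + (∫ x, |V x|) ^ 2 := by
    calc (∫ x, V x ^ 2) * vol = ∫ _ in Metric.ball (0 : E) r, (∫ x, V x ^ 2) := by
          rw [setIntegral_const, smul_eq_mul, mul_comm]
      _ ≤ ∫ y in Metric.ball (0 : E) r, (r ^ 2 / 2 * D + ∫ x, |V x| * |V (x + y)|) :=
          setIntegral_mono_on (hconst _) ((hconst _).add hcross.integrableOn)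
            measurableSet_ball hball
      _ = r ^ 2 / 2 * D * vol + ∫ y in Metric.ball (0 : E) r, ∫ x, |V x| * |V (x + y)| := by
          rw [integral_add (hconst _) hcross.integrableOn, setIntegral_const, smul_eq_mul, mul_comm]
      _ ≤ r ^ 2 / 2 * D * vol + (∫ x, |V x|) ^ 2 := by
          rw [← integral_integral_abs_mul_abs_add hV.continuous hi]
          refine add_le_add_right ?_ _
          exact setIntegral_le_integral hcross (Eventually.of_forall fun y =>
            integral_nonneg fun x => by positivity)
  calc ∫ x, V x ^ 2 ≤ (r ^ 2 / 2 * D * vol + (∫ x, |V x|) ^ 2) / vol :=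
        (le_div_iff₀ hvol).2 havg
    _ = r ^ 2 / 2 * D + (∫ x, |V x|) ^ 2 / vol := by rw [add_div, mul_div_cancel_right₀ _ hvol.ne']

end Nash

section Dissipation

variable {E : Type*} [NormedAddCommGroup E] [InnerProductSpace ℝ E] [FiniteDimensional ℝ E]
  {k κ f g : E → ℝ} {p q : ℝ → ℝ}

theorem sum_sq_apply_orthonormalBasis {ι : Type*} [Fintype ι] (b : OrthonormalBasis ι ℝ E)
    (l : E →L[ℝ] ℝ) : ∑ i, l (b i) ^ 2 = ‖l‖ ^ 2 := by
  obtain ⟨v, rfl⟩ := (InnerProductSpace.toDual ℝ E).surjective l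
  rw [LinearIsometryEquiv.norm_map, ← b.sum_sq_norm_inner_left v]
  simp

theorem neg_mul_apply_mul_le {G : Type*} [NormedAddCommGroup G] [NormedSpace ℝ G]
    {c L : ℝ} (hc : 0 ≤ c) (hcL : c ≤ L) (l : G →L[ℝ] ℝ) (a : G)
    (e : ℝ) :
    -(c * (l a * e)) ≤ 1 / 2 * (c * ‖l‖ ^ 2) + L * ‖a‖ ^ 2 / 2 * e ^ 2 := by
  have hle : -(l a * e) ≤ ‖l‖ ^ 2 / 2 + ‖a‖ ^ 2 * e ^ 2 / 2 := by
    calc -(l a * e) ≤ |l a| * |e| := (neg_le_abs _).trans_eq (abs_mul _ _)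
      _ ≤ ‖l‖ * ‖a‖ * |e| := mul_le_mul_of_nonneg_right (l.le_opNorm a) (abs_nonneg e)
      _ = ‖l‖ * (‖a‖ * |e|) := mul_assoc _ _ _
      _ ≤ (‖l‖ ^ 2 + (‖a‖ * |e|) ^ 2) / 2 := by linarith [two_mul_le_add_sq ‖l‖ (‖a‖ * |e|)]
      _ = ‖l‖ ^ 2 / 2 + ‖a‖ ^ 2 * e ^ 2 / 2 := by rw [mul_pow, sq_abs, add_div]
  calc -(c * (l a * e)) = c * -(l a * e) := by ring
    _ ≤ c * (‖l‖ ^ 2 / 2 + ‖a‖ ^ 2 * e ^ 2 / 2) := mul_le_mul_of_nonneg_left hle hc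
    _ = 1 / 2 * (c * ‖l‖ ^ 2) + c * (‖a‖ ^ 2 * e ^ 2 / 2) := by ring
    _ ≤ 1 / 2 * (c * ‖l‖ ^ 2) + L * (‖a‖ ^ 2 * e ^ 2 / 2) := by gcongr
    _ = 1 / 2 * (c * ‖l‖ ^ 2) + L * ‖a‖ ^ 2 / 2 * e ^ 2 := by ring

theorem IsTestFunction.laplacian_eq_sum_fderiv (hk : IsTestFunction k) :
    Laplacian.laplacian k = fun x => ∑ i, fderiv ℝ
      (fun y => fderiv ℝ k y (stdOrthonormalBasis ℝ E i)) x (stdOrthonormalBasis ℝ E i) := by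
  funext x
  rw [InnerProductSpace.laplacian_eq_iteratedFDeriv_stdOrthonormalBasis]
  refine Finset.sum_congr rfl fun i _ => ?_
  have hd : DifferentiableAt ℝ (fderiv ℝ k) x :=
    (hk.contDiff.fderiv_right (m := ∞) (by simp)).differentiable (by simp) x
  rw [iteratedFDeriv_two_apply, fderiv_clm_apply hd (differentiableAt_const _)]
  simp

theorem IsTestFunction.laplacian (hk : IsTestFunction k) :
    IsTestFunction (Laplacian.laplacian k) := by
  rw [hk.laplacian_eq_sum_fderiv]
  have hi (i) := (hk.fderiv_apply (stdOrthonormalBasis ℝ E i)).fderiv_apply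
    (stdOrthonormalBasis ℝ E i)
  refine ⟨ContDiff.sum fun i _ => (hi i).contDiff, ?_⟩
  rw [← Finset.sum_fn]
  exact Finset.sum_induction _ HasCompactSupport (fun _ _ => HasCompactSupport.add)
    HasCompactSupport.zero fun i _ => (hi i).hasCompactSupport

variable [MeasurableSpace E] [BorelSpace E]

theorem IsTestFunction.integrable_comp_mollify_mul (hk : IsTestFunction k) (hp : Continuous p)
    (hf : Integrable f) (hg : Integrable g) : Integrable fun x => p (mollify k f x) * g x := by
  obtain ⟨B, -, hB⟩ := hk.exists_abs_le
  obtain ⟨C, hC⟩ := (isCompact_Icc (a := -(B * ∫ y, |f y|)) (b := B * ∫ y, |f y|)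
    ).exists_bound_of_continuousOn hp.continuousOn
  exact hg.bdd_mul (hp.comp (hk.continuous_mollify hf)).aestronglyMeasurable
    (Eventually.of_forall fun x => hC _ (abs_le.1 (abs_mollify_le_mul_integral_abs hB hf x)))

theorem IsTestFunction.integrable_fderiv_mollify (hk : IsTestFunction k) (hf : Integrable f)
    (e : E) : Integrable fun x => fderiv ℝ (mollify k f) x e := by
  simp only [hk.fderiv_mollify_apply hf]
  exact (hk.fderiv_apply e).integrable_mollify hf

theorem IsTestFunction.integrable_fderiv_mollify_mul (hk : IsTestFunction k)
    (hκ : IsTestFunction κ) (hf : Integrable f) (hg : Integrable g) (e : E) :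
    Integrable fun x => fderiv ℝ (mollify k f) x e * mollify κ g x := by
  simpa only [id_eq, mul_comm] using
    hκ.integrable_comp_mollify_mul continuous_id hg (hk.integrable_fderiv_mollify hf e)

theorem IsTestFunction.integrable_norm_fderiv_mollify_sq (hk : IsTestFunction k)
    (hf : Integrable f) : Integrable fun x => ‖fderiv ℝ (mollify k f) x‖ ^ 2 := by
  simp only [← sum_sq_apply_orthonormalBasis (stdOrthonormalBasis ℝ E)]
  refine integrable_finsetSum _ fun i _ => ?_
  simpa only [sq, hk.fderiv_mollify_apply hf] using hk.integrable_fderiv_mollify_mul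
    (hk.fderiv_apply (stdOrthonormalBasis ℝ E i)) hf hf (stdOrthonormalBasis ℝ E i)

theorem IsTestFunction.hasFDerivAt_comp_mollify (hk : IsTestFunction k) (hf : Integrable f)
    (hp : ∀ s, HasDerivAt p (q s) s) (x : E) :
    HasFDerivAt (fun x => p (mollify k f x)) (q (mollify k f x) • fderiv ℝ (mollify k f) x) x :=
  (hp _).comp_hasFDerivAt x (hk.differentiable_mollify hf x).hasFDerivAt

theorem IsTestFunction.integral_comp_mollify_mul_fderiv (hk : IsTestFunction k)
    (hκ : IsTestFunction κ) (hf : Integrable f) (hg : Integrable g)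
    (hp : ∀ s, HasDerivAt p (q s) s) (hq : Continuous q) (e : E) :
    ∫ x, p (mollify k f x) * fderiv ℝ (mollify κ g) x e =
      -∫ x, q (mollify k f x) * (fderiv ℝ (mollify k f) x e * mollify κ g x) := by
  have hpc : Continuous p := continuous_iff_continuousAt.2 fun s => (hp s).continuousAt
  have hpU := hk.hasFDerivAt_comp_mollify hf hp
  have hfderiv (x : E) : fderiv ℝ (fun x => p (mollify k f x)) x e * mollify κ g x =
      q (mollify k f x) * (fderiv ℝ (mollify k f) x e * mollify κ g x) := by
    rw [(hpU x).fderiv, smul_apply, smul_eq_mul, mul_assoc]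
  simp only [← hfderiv]
  refine integral_mul_fderiv_eq_neg_fderiv_mul_of_integrable ?_
    (hk.integrable_comp_mollify_mul hpc hf (hκ.integrable_fderiv_mollify hg e))
    (hk.integrable_comp_mollify_mul hpc hf (hκ.integrable_mollify hg))
    (fun x _ => (hpU x).differentiableAt) fun x _ => hκ.differentiable_mollify hg x
  simp only [hfderiv]
  exact hk.integrable_comp_mollify_mul hq hf (hk.integrable_fderiv_mollify_mul hκ hf hg e)

theorem IsTestFunction.integral_comp_mollify_mul_fderiv_self (hk : IsTestFunction k)
    (hf : Integrable f) (hq : Continuous q) (e : E) :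
    ∫ x, q (mollify k f x) * fderiv ℝ (mollify k f) x e = 0 := by
  set P : ℝ → ℝ := fun s => ∫ t in (0 : ℝ)..s, q t
  have hP (s : ℝ) : HasDerivAt P (q s) s := (hq.integral_hasStrictDerivAt 0 s).hasDerivAt
  have hPU := hk.hasFDerivAt_comp_mollify hf hP
  have hfderiv (x : E) : fderiv ℝ (fun x => P (mollify k f x)) x e =
      q (mollify k f x) * fderiv ℝ (mollify k f) x e := by
    rw [(hPU x).fderiv, smul_apply, smul_eq_mul]
  -- `P s = s ∫₀¹ q(ts) dt` has a continuous quotient by `s`, which makes `P ∘ (k ∗ f)` integrable.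
  have hPmul (s : ℝ) : P s = (∫ t in (0 : ℝ)..1, q (s * t)) * s := by
    rw [mul_comm, intervalIntegral.mul_integral_comp_mul_left, mul_zero, mul_one]
  have hquot : Continuous fun s : ℝ => ∫ t in (0 : ℝ)..1, q (s * t) :=
    intervalIntegral.continuous_parametric_intervalIntegral_of_continuous' (by fun_prop) 0 1
  have hint : Integrable fun x => P (mollify k f x) := by
    simp only [hPmul]
    exact hk.integrable_comp_mollify_mul hquot hf (hk.integrable_mollify hf)
  simp only [← hfderiv]
  have := integral_mul_fderiv_eq_neg_fderiv_mul_of_integrable (μ := (volume : Measure E))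
    (f := fun _ => (1 : ℝ)) (g := fun x => P (mollify k f x)) (v := e) (by simp) ?_
    (by simpa using hint) (fun x _ => by fun_prop) (fun x _ => (hPU x).differentiableAt)
  · simpa using this
  · simpa only [one_mul, hfderiv] using
      hk.integrable_comp_mollify_mul hq hf (hk.integrable_fderiv_mollify hf e)

theorem IsTestFunction.mollify_laplacian (hk : IsTestFunction k) (hf : Integrable f) (x : E) :
    mollify (Laplacian.laplacian k) f x =
      ∑ i, fderiv ℝ (mollify (fun z => fderiv ℝ k z (stdOrthonormalBasis ℝ E i)) f) x
        (stdOrthonormalBasis ℝ E i) := by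
  have hi (i) := hk.fderiv_apply (stdOrthonormalBasis ℝ E i)
  simp only [(hi _).fderiv_mollify_apply hf, mollify_apply, hk.laplacian_eq_sum_fderiv,
    Finset.mul_sum]
  exact integral_finsetSum _ fun i _ => ((hi i).fderiv_apply _).integrable_mul_sub hf x

theorem IsTestFunction.integral_comp_mollify_mul_laplacian (hk : IsTestFunction k)
    (hf : Integrable f) (hp : ∀ s, HasDerivAt p (q s) s) (hq : Continuous q) :
    ∫ x, p (mollify k f x) * mollify (Laplacian.laplacian k) f x =
      -∫ x, q (mollify k f x) * ‖fderiv ℝ (mollify k f) x‖ ^ 2 := by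
  have hpc : Continuous p := continuous_iff_continuousAt.2 fun s => (hp s).continuousAt
  have hi (i) := hk.fderiv_apply (stdOrthonormalBasis ℝ E i)
  simp only [hk.mollify_laplacian hf, Finset.mul_sum,
    ← sum_sq_apply_orthonormalBasis (stdOrthonormalBasis ℝ E)]
  rw [integral_finsetSum _ fun i _ =>
      hk.integrable_comp_mollify_mul hpc hf ((hi i).integrable_fderiv_mollify hf _),
    integral_finsetSum, ← Finset.sum_neg_distrib]
  · refine Finset.sum_congr rfl fun i _ => ?_
    rw [hk.integral_comp_mollify_mul_fderiv (hi i) hf hf hp hq]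
    simp only [sq, hk.fderiv_mollify_apply hf]
  · intro i _
    simpa only [sq, ← hk.fderiv_mollify_apply hf] using hk.integrable_comp_mollify_mul hq hf
      (hk.integrable_fderiv_mollify_mul (hi i) hf hf (stdOrthonormalBasis ℝ E i))

-- The flux `F(k ∗ f)` does not contribute, as `q(U) F(U) ∂ₐU` is a total derivative; only the
-- commutator remains.
theorem IsTestFunction.integral_comp_mollify_mul_convection (hk : IsTestFunction k)
    (hf : Integrable f) (hg : Integrable g) (hp : ∀ s, HasDerivAt p (q s) s) (hq : Continuous q)
    {F : ℝ → ℝ} (hF : Continuous F) (a : E) :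
    Integrable (fun x => q (mollify k f x) *
        (fderiv ℝ (mollify k f) x a * (mollify k g x - F (mollify k f x)))) ∧
      ∫ x, p (mollify k f x) * fderiv ℝ (mollify k g) x a =
        -∫ x, q (mollify k f x) *
          (fderiv ℝ (mollify k f) x a * (mollify k g x - F (mollify k f x))) := by
  have hcross := hk.integrable_comp_mollify_mul hq hf (hk.integrable_fderiv_mollify_mul hk hf hg a)
  have hflux := hk.integrable_comp_mollify_mul (hq.fun_mul hF) hf
    (hk.integrable_fderiv_mollify hf a)
  have hzero := hk.integral_comp_mollify_mul_fderiv_self hf (hq.fun_mul hF) a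
  have hsplit : (fun x => q (mollify k f x) *
      (fderiv ℝ (mollify k f) x a * (mollify k g x - F (mollify k f x)))) =
      fun x => q (mollify k f x) * (fderiv ℝ (mollify k f) x a * mollify k g x) -
        q (mollify k f x) * F (mollify k f x) * fderiv ℝ (mollify k f) x a := by
    funext x
    ring
  rw [hsplit]
  refine ⟨hcross.sub hflux, ?_⟩
  rw [integral_sub hcross hflux, hzero, sub_zero,
    hk.integral_comp_mollify_mul_fderiv hk hf hg hp hq]

/-- The right-hand side `Δ(k ∗ f) + a·∇(k ∗ g)` of the mollified equation, with the derivatives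
put on the kernel. -/
noncomputable def mollifiedRHS (a : E) (k f g : E → ℝ) (x : E) : ℝ :=
  mollify (Laplacian.laplacian k) f x + mollify (fun z => fderiv ℝ k z a) g x

theorem IsTestFunction.integrable_mollifiedRHS (hk : IsTestFunction k) (hf : Integrable f)
    (hg : Integrable g) (a : E) : Integrable (mollifiedRHS a k f g) :=
  (hk.laplacian.integrable_mollify hf).add ((hk.fderiv_apply a).integrable_mollify hg)

theorem IsMollifier.integral_comp_mollify_mul_rhs_le (hk : IsMollifier k) (hf : Integrable f)
    (hg : Integrable g) (hp : ∀ s, HasDerivAt p (q s) s) (hq : Continuous q)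
    (hq0 : ∀ s, 0 ≤ q s) {F : ℝ → ℝ} (hF : Continuous F) {M L : ℝ} (hM : ∀ x, |f x| ≤ M)
    (hL : ∀ s, |s| ≤ M → q s ≤ L) (a : E)
    (hcomm : Integrable fun x => (mollify k g x - F (mollify k f x)) ^ 2) :
    ∫ x, p (mollify k f x) * mollifiedRHS a k f g x ≤
      -(1 / 2) * (∫ x, q (mollify k f x) * ‖fderiv ℝ (mollify k f) x‖ ^ 2)
        + L * ‖a‖ ^ 2 / 2 * ∫ x, (mollify k g x - F (mollify k f x)) ^ 2 := by
  have hkt := hk.toIsTestFunction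
  have hpc : Continuous p := continuous_iff_continuousAt.2 fun s => (hp s).continuousAt
  have hdiss : Integrable fun x => q (mollify k f x) * ‖fderiv ℝ (mollify k f) x‖ ^ 2 :=
    hkt.integrable_comp_mollify_mul hq hf (hkt.integrable_norm_fderiv_mollify_sq hf)
  obtain ⟨hconv_int, hconv⟩ := hkt.integral_comp_mollify_mul_convection hf hg hp hq hF a
  have hconv_le : -(∫ x, q (mollify k f x) *
      (fderiv ℝ (mollify k f) x a * (mollify k g x - F (mollify k f x)))) ≤
      1 / 2 * (∫ x, q (mollify k f x) * ‖fderiv ℝ (mollify k f) x‖ ^ 2)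
        + L * ‖a‖ ^ 2 / 2 * ∫ x, (mollify k g x - F (mollify k f x)) ^ 2 := by
    rw [← integral_neg, ← integral_const_mul, ← integral_const_mul,
      ← integral_add (hdiss.const_mul _) (hcomm.const_mul _)]
    exact integral_mono hconv_int.neg ((hdiss.const_mul _).add (hcomm.const_mul _)) fun x =>
      neg_mul_apply_mul_le (hq0 _) (hL _ (hk.abs_mollify_le hM x)) _ a _
  simp only [mollifiedRHS, mul_add, ← hkt.fderiv_mollify_apply hg]
  rw [integral_add (hkt.integrable_comp_mollify_mul hpc hf (hkt.laplacian.integrable_mollify hf))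
      (hkt.integrable_comp_mollify_mul hpc hf (hkt.integrable_fderiv_mollify hg a)),
    hkt.integral_comp_mollify_mul_laplacian hf hp hq, hconv]
  linarith

end Dissipation

/-- `h` is the weak derivative of `g` on the half line `(0, ∞)`. -/
def HasWeakDerivOnPos (g h : ℝ → ℝ) : Prop :=
  ∀ χ : ℝ → ℝ, IsTestFunction χ → tsupport χ ⊆ Ioi 0 →
    ∫ t in Ioi (0 : ℝ), (deriv χ t * g t + χ t * h t) = 0

section WeakDerivative

theorem tsupport_comp_sub_left {E : Type*} [NormedAddCommGroup E] (k : E → ℝ) (x : E) :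
    tsupport (fun y => k (x - y)) = (x - ·) ⁻¹' tsupport k :=
  tsupport_comp_eq_preimage k (Homeomorph.subLeft x)

variable {E : Type*} [NormedAddCommGroup E] [NormedSpace ℝ E] {k : E → ℝ} {g h : ℝ → ℝ}

theorem IsTestFunction.comp_sub_left (hk : IsTestFunction k) (x : E) :
    IsTestFunction fun y => k (x - y) where
  contDiff := hk.contDiff.comp (contDiff_const.sub contDiff_id)
  hasCompactSupport := hk.hasCompactSupport.comp_homeomorph (Homeomorph.subLeft x)

theorem HasWeakDerivOnPos.hasDerivAt_convolution (H : HasWeakDerivOnPos g h) (hg : Continuous g)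
    (hh : Continuous h) {η : ℝ → ℝ} (hη : IsTestFunction η) {s : ℝ}
    (hs : tsupport (fun y => η (s - y)) ⊆ Ioi 0) :
    HasDerivAt (convolution η g (ContinuousLinearMap.lsmul ℝ ℝ) volume)
      (convolution η h (ContinuousLinearMap.lsmul ℝ ℝ) volume s) s := by
  have hχ := hη.comp_sub_left s
  have hderiv (y : ℝ) : deriv (fun y => η (s - y)) y = -deriv η (s - y) :=
    deriv_comp_const_sub _ _ _
  have hint_g : Integrable fun y => deriv (fun y => η (s - y)) y * g y :=
    ((hχ.contDiff.continuous_deriv (by simp)).mul hg).integrable_of_hasCompactSupport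
      hχ.hasCompactSupport.deriv.mul_right
  have hint_h : Integrable fun y => η (s - y) * h y :=
    (hχ.continuous.mul hh).integrable_of_hasCompactSupport hχ.hasCompactSupport.mul_right
  have htest := H _ hχ hs
  rw [setIntegral_eq_integral_of_forall_compl_eq_zero fun y hy => ?_,
    integral_add hint_g hint_h] at htest
  · simp only [hderiv, neg_mul, integral_neg, neg_add_eq_zero] at htest
    have hconv : convolution (deriv η) g (ContinuousLinearMap.lsmul ℝ ℝ) volume s =
        convolution η h (ContinuousLinearMap.lsmul ℝ ℝ) volume s := by
      simpa only [convolution_eq_swap] using! htest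
    rw [← hconv]
    exact hη.hasCompactSupport.hasDerivAt_convolution_left _ (hη.contDiff.of_le (by simp))
      hg.locallyIntegrable s
  · have hy' : y ∉ tsupport fun y => η (s - y) := fun hmem => hy (hs hmem)
    rw [image_eq_zero_of_notMem_tsupport hy',
      image_eq_zero_of_notMem_tsupport fun hmem => hy' (tsupport_deriv_subset hmem),
      zero_mul, zero_mul, add_zero]

theorem tendstoUniformlyOnFilter_convolution_shrinkingBump (hh : Continuous h) (t : ℝ) :
    TendstoUniformlyOnFilter (fun n => convolution ((shrinkingBump n).normed volume) h
      (ContinuousLinearMap.lsmul ℝ ℝ) volume) h atTop (𝓝 t) := by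
  have hlim : Tendsto (fun q : ℕ × ℝ => convolution ((shrinkingBump q.1).normed volume) h
      (ContinuousLinearMap.lsmul ℝ ℝ) volume q.2) (atTop ×ˢ 𝓝 t) (𝓝 (h t)) :=
    ContDiffBump.convolution_tendsto_right (μ := volume)
      (tendsto_rOut_shrinkingBump.comp tendsto_fst)
      (Eventually.of_forall fun _ => hh.aestronglyMeasurable) ((hh.tendsto t).comp tendsto_snd)
      tendsto_snd
  rw [tendstoUniformlyOnFilter_iff_tendsto]
  exact (((hh.tendsto t).comp tendsto_snd).prodMk_nhds hlim).mono_right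
    (nhds_le_uniformity (h t))

theorem HasWeakDerivOnPos.hasDerivAt (H : HasWeakDerivOnPos g h) (hg : Continuous g)
    (hh : Continuous h) {t : ℝ} (ht : 0 < t) : HasDerivAt g (h t) t := by
  refine hasDerivAt_of_tendstoUniformlyOnFilter
    (tendstoUniformlyOnFilter_convolution_shrinkingBump hh t) ?_
    (Eventually.of_forall fun s => ContDiffBump.convolution_tendsto_right_of_continuous
      (μ := volume) (tendsto_rOut_shrinkingBump (E := ℝ)) hg s)
  filter_upwards [((tendsto_rOut_shrinkingBump (E := ℝ)).eventually_lt_const (half_pos ht)).prod_mk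
    (lt_mem_nhds (half_lt_self ht))] with ⟨n, s⟩ ⟨hn, hs⟩
  refine H.hasDerivAt_convolution hg hh
    ⟨(shrinkingBump n).contDiff_normed, (shrinkingBump n).hasCompactSupport_normed⟩ ?_
  rw [tsupport_comp_sub_left, (shrinkingBump n).tsupport_normed_eq]
  intro y hy
  simp only [mem_preimage, mem_closedBall_zero_iff, Real.norm_eq_abs] at hy
  simp only [mem_Ioi]
  linarith [le_abs_self (s - y)]

end WeakDerivative

/-- Bounded functions of time and space that are continuous in time with values in `L¹`, defined
for all real times and everywhere in space. -/
structure IsBoundedL1Curve {E : Type*} [MeasureSpace E] (v : ℝ → E → ℝ) (M : ℝ) : Prop where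
  measurable : ∀ t, Measurable (v t)
  integrable : ∀ t, Integrable (v t)
  abs_le : ∀ t x, |v t x| ≤ M
  tendsto : ∀ t, Tendsto (fun s => ∫ x, |v s x - v t x|) (𝓝 t) (𝓝 0)

namespace IsBoundedL1Curve

open scoped NNReal

theorem continuous_integral_abs {E : Type*} [MeasureSpace E] {v : ℝ → E → ℝ} {M : ℝ}
    (hv : IsBoundedL1Curve v M) : Continuous fun t => ∫ x, |v t x| := by
  refine continuous_iff_continuousAt.2 fun t => tendsto_iff_dist_tendsto_zero.2
    (squeeze_zero (fun _ => dist_nonneg) (fun s => ?_) (hv.tendsto t))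
  rw [Real.dist_eq, ← integral_sub (hv.integrable s).abs (hv.integrable t).abs]
  exact abs_integral_le_integral_abs.trans (integral_mono
    ((hv.integrable s).abs.sub (hv.integrable t).abs).abs
    ((hv.integrable s).sub (hv.integrable t)).abs fun x => abs_abs_sub_abs_le_abs_sub _ _)

variable {E : Type*} [NormedAddCommGroup E] [InnerProductSpace ℝ E] [FiniteDimensional ℝ E]
  [MeasurableSpace E] [BorelSpace E] {v w : ℝ → E → ℝ} {M M' : ℝ} {k : E → ℝ}

theorem nonneg (hv : IsBoundedL1Curve v M) : 0 ≤ M := (abs_nonneg _).trans (hv.abs_le 0 0)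

theorem mem_Icc (hv : IsBoundedL1Curve v M) (t : ℝ) (x : E) : v t x ∈ Icc (-M) M :=
  _root_.abs_le.1 (hv.abs_le t x)

theorem abs_comp_le (hv : IsBoundedL1Curve v M) {F : ℝ → ℝ} (hF0 : F 0 = 0) {K : ℝ≥0}
    (hK : LipschitzOnWith K F (Icc (-M) M)) (t : ℝ) (x : E) : |F (v t x)| ≤ K * |v t x| := by
  simpa only [Real.norm_eq_abs, hF0, sub_zero] using hK.norm_sub_le (hv.mem_Icc t x)
    (⟨neg_nonpos.2 hv.nonneg, hv.nonneg⟩ : (0 : ℝ) ∈ Icc (-M) M)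

theorem comp (hv : IsBoundedL1Curve v M) {F : ℝ → ℝ} (hF : Continuous F) (hF0 : F 0 = 0) {K : ℝ≥0}
    (hK : LipschitzOnWith K F (Icc (-M) M)) : IsBoundedL1Curve (fun t x => F (v t x)) (K * M) := by
  have hle := hv.abs_comp_le hF0 hK
  have hint (t : ℝ) : Integrable fun x => F (v t x) :=
    ((hv.integrable t).abs.const_mul K).mono'
      (hF.measurable.comp (hv.measurable t)).aestronglyMeasurable (Eventually.of_forall (hle t))
  refine ⟨fun t => hF.measurable.comp (hv.measurable t), hint, fun t x =>
    (hle t x).trans (mul_le_mul_of_nonneg_left (hv.abs_le t x) K.2), fun t => ?_⟩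
  refine squeeze_zero (fun s => integral_nonneg fun x => abs_nonneg _) (fun s => ?_)
    (by simpa only [mul_zero] using (hv.tendsto t).const_mul (K : ℝ))
  rw [← integral_const_mul]
  exact integral_mono ((hint s).sub (hint t)).abs
    (((hv.integrable s).sub (hv.integrable t)).abs.const_mul _)
    fun x => hK.norm_sub_le (hv.mem_Icc s x) (hv.mem_Icc t x)

theorem continuous_mollify (hv : IsBoundedL1Curve v M) (hk : IsTestFunction k) :
    Continuous fun p : ℝ × E => mollify k (v p.1) p.2 := by
  obtain ⟨B, -, hB⟩ := hk.exists_abs_le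
  refine continuous_iff_continuousAt.2 fun ⟨t, x⟩ => ?_
  have hdiff : Tendsto (fun p : ℝ × E => mollify k (fun y => v p.1 y - v t y) p.2)
      (𝓝 (t, x)) (𝓝 0) :=
    squeeze_zero_norm (fun p => abs_mollify_le_mul_integral_abs hB
      ((hv.integrable p.1).sub (hv.integrable t)) p.2)
      ((((hv.tendsto t).comp (continuous_fst.tendsto (t, x))).const_mul B).trans_eq
        (by rw [mul_zero]))
  have hfixed : Tendsto (fun p : ℝ × E => mollify k (v t) p.2) (𝓝 (t, x))
      (𝓝 (mollify k (v t) x)) :=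
    ((hk.continuous_mollify (hv.integrable t)).comp continuous_snd).tendsto (t, x)
  refine ((hdiff.add hfixed).congr fun p => ?_).trans_eq (by rw [zero_add])
  rw [hk.mollify_sub (hv.integrable p.1) (hv.integrable t), sub_add_cancel]

theorem continuous_mollify_left (hv : IsBoundedL1Curve v M) (hk : IsTestFunction k) (x : E) :
    Continuous fun t => mollify k (v t) x :=
  (hv.continuous_mollify hk).comp (Continuous.prodMk_left x)

theorem continuous_mollifiedRHS (hv : IsBoundedL1Curve v M) (hw : IsBoundedL1Curve w M')
    (hk : IsTestFunction k) (a : E) :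
    Continuous fun p : ℝ × E => mollifiedRHS a k (v p.1) (w p.1) p.2 :=
  (hv.continuous_mollify hk.laplacian).add (hw.continuous_mollify (hk.fderiv_apply a))

theorem mollified (hv : IsBoundedL1Curve v M) (hk : IsTestFunction k) :
    IsBoundedL1Curve (fun t => mollify k (v t)) (M * ∫ x, |k x|) where
  measurable t := (hk.continuous_mollify (hv.integrable t)).measurable
  integrable t := hk.integrable_mollify (hv.integrable t)
  abs_le t := hk.abs_mollify_le (hv.abs_le t)
  tendsto t := by
    refine squeeze_zero (fun s => integral_nonneg fun x => abs_nonneg _) (fun s => ?_)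
      (((hv.tendsto t).mul_const (∫ x, |k x|)).trans_eq (by rw [zero_mul]))
    simp only [← hk.mollify_sub (hv.integrable s) (hv.integrable t)]
    exact hk.integral_abs_mollify_le ((hv.integrable s).sub (hv.integrable t))

theorem mollified_of_isMollifier (hv : IsBoundedL1Curve v M) (hk : IsMollifier k) :
    IsBoundedL1Curve (fun t => mollify k (v t)) M := by
  simpa only [hk.integral_abs, mul_one] using hv.mollified hk.toIsTestFunction

theorem sub (hv : IsBoundedL1Curve v M) (hw : IsBoundedL1Curve w M') :
    IsBoundedL1Curve (fun t x => v t x - w t x) (M + M') where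
  measurable t := (hv.measurable t).sub (hw.measurable t)
  integrable t := (hv.integrable t).sub (hw.integrable t)
  abs_le t x := (abs_sub _ _).trans (add_le_add (hv.abs_le t x) (hw.abs_le t x))
  tendsto t := by
    refine squeeze_zero (fun s => integral_nonneg fun x => abs_nonneg _) (fun s => ?_)
      (((hv.tendsto t).add (hw.tendsto t)).trans_eq (by rw [add_zero]))
    have hvi : Integrable fun x => |v s x - v t x| :=
      ((hv.integrable s).sub (hv.integrable t)).abs
    have hwi : Integrable fun x => |w s x - w t x| :=
      ((hw.integrable s).sub (hw.integrable t)).abs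
    rw [← integral_add hvi hwi]
    refine integral_mono (((hv.integrable s).sub (hw.integrable s)).sub
      ((hv.integrable t).sub (hw.integrable t))).abs (hvi.add hwi) fun x => ?_
    exact (congrArg abs (sub_sub_sub_comm _ _ _ _)).trans_le (abs_sub _ _)

theorem integrable_prod_mul (hv : IsBoundedL1Curve v M)
    (hvc : Continuous fun q : ℝ × E => v q.1 q.2) {c : ℝ → ℝ} (hc : Continuous c) (t : ℝ) :
    Integrable (fun q : ℝ × E => c q.1 * v q.1 q.2) ((volume.restrict (Ioc 0 t)).prod volume) := by
  have hmeas : Continuous fun q : ℝ × E => c q.1 * v q.1 q.2 := (hc.comp continuous_fst).mul hvc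
  refine (integrable_prod_iff hmeas.aestronglyMeasurable).2
    ⟨Eventually.of_forall fun τ => (hv.integrable τ).const_mul (c τ), ?_⟩
  simp only [norm_mul, integral_const_mul]
  exact (hc.norm.mul hv.continuous_integral_abs).integrableOn_Icc.mono_set Ioc_subset_Icc_self

end IsBoundedL1Curve

section MollifiedEquation

theorem fderiv_comp_sub_left {E : Type*} [NormedAddCommGroup E] [NormedSpace ℝ E] {k : E → ℝ}
    (hk : Differentiable ℝ k) (x y e : E) :
    fderiv ℝ (fun y => k (x - y)) y e = -fderiv ℝ k (x - y) e := by
  have hsub : HasFDerivAt (x - ·) (-ContinuousLinearMap.id ℝ E) y :=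
    (hasFDerivAt_id y).const_sub x
  have hcomp : HasFDerivAt (fun y => k (x - y))
      ((fderiv ℝ k (x - y)).comp (-ContinuousLinearMap.id ℝ E)) y :=
    (hk (x - y)).hasFDerivAt.comp y hsub
  rw [hcomp.fderiv]
  simp

theorem IsTestFunction.laplacian_comp_sub_left {E : Type*} [NormedAddCommGroup E]
    [InnerProductSpace ℝ E] [FiniteDimensional ℝ E] {k : E → ℝ} (hk : IsTestFunction k) (x y : E) :
    Laplacian.laplacian (fun y => k (x - y)) y = Laplacian.laplacian k (x - y) := by
  simp only [(hk.comp_sub_left x).laplacian_eq_sum_fderiv, hk.laplacian_eq_sum_fderiv,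
    fderiv_comp_sub_left hk.differentiable, fderiv_fun_neg, neg_apply,
    fderiv_comp_sub_left (hk.fderiv_apply _).differentiable, neg_neg]

variable {N : ℕ} {χ : ℝ → ℝ} {k : EuclideanSpace ℝ (Fin N) → ℝ}

theorem IsTestFunction.isParabolicTest_mul (hχ : IsTestFunction χ) (hχ0 : tsupport χ ⊆ Ioi 0)
    (hk : IsTestFunction k) : IsParabolicTest fun s y => χ s * k y where
  smooth := (hχ.contDiff.comp contDiff_fst).mul (hk.contDiff.comp contDiff_snd)
  compact_support :=
    HasCompactSupport.intro (hχ.hasCompactSupport.isCompact.prod hk.hasCompactSupport.isCompact)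
      fun p hp => by
        by_contra hne
        obtain ⟨hχp, hkp⟩ := mul_ne_zero_iff.1 hne
        exact hp ⟨subset_tsupport _ hχp, subset_tsupport _ hkp⟩
  support_pos := by
    have hsub : tsupport (Function.uncurry fun s y => χ s * k y) ⊆ tsupport χ ×ˢ univ :=
      closure_minimal (fun p hp => ⟨subset_tsupport _ (mul_ne_zero_iff.1 hp).1, mem_univ _⟩)
        ((isClosed_tsupport χ).prod isClosed_univ)
    exact hsub.trans (prod_mono hχ0 le_rfl)

variable {f g : EuclideanSpace ℝ (Fin N) → ℝ}

theorem IsTestFunction.integral_mul_deriv_add_laplacian (hχ : IsTestFunction χ)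
    (hk : IsTestFunction k) (hf : Integrable f) (x : EuclideanSpace ℝ (Fin N)) (t : ℝ) :
    ∫ y, f y * (deriv (fun s => χ s * k (x - y)) t +
        Laplacian.laplacian (fun y => χ t * k (x - y)) y) =
      deriv χ t * mollify k f x + χ t * mollify (Laplacian.laplacian k) f x := by
  have hlap (y : EuclideanSpace ℝ (Fin N)) : Laplacian.laplacian (fun y => χ t * k (x - y)) y =
      χ t * Laplacian.laplacian k (x - y) := by
    have hsmooth : ContDiff ℝ 2 fun y => k (x - y) :=
      contDiff_infty.1 (hk.comp_sub_left x).contDiff 2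
    rw [← hk.laplacian_comp_sub_left]
    exact InnerProductSpace.laplacian_smul (χ t) hsmooth.contDiffAt
  simp only [hlap, deriv_mul_const (hχ.differentiable t)]
  calc ∫ y, f y * (deriv χ t * k (x - y) + χ t * Laplacian.laplacian k (x - y))
      = ∫ y, (deriv χ t * (f y * k (x - y)) + χ t * (f y * Laplacian.laplacian k (x - y))) := by
        congr with y
        ring
    _ = deriv χ t * mollify k f x + χ t * mollify (Laplacian.laplacian k) f x := by
        rw [integral_add ((hk.integrable_mul_sub hf x).const_mul _)
          ((hk.laplacian.integrable_mul_sub hf x).const_mul _), integral_const_mul,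
          integral_const_mul, mollify_apply, mollify_apply]

theorem IsTestFunction.integral_mul_fderiv_const_mul (hk : IsTestFunction k) (c : ℝ)
    (x a : EuclideanSpace ℝ (Fin N)) :
    ∫ y, g y * fderiv ℝ (fun y => c * k (x - y)) y a =
      -(c * mollify (fun z => fderiv ℝ k z a) g x) := by
  rw [mollify_apply, ← integral_const_mul, ← integral_neg]
  congr with y
  rw [fderiv_const_mul ((hk.comp_sub_left x).differentiable y), smul_apply, smul_eq_mul,
    fderiv_comp_sub_left hk.differentiable]
  ring

theorem IsBoundedL1Curve.hasDerivAt_mollify {v w : ℝ → EuclideanSpace ℝ (Fin N) → ℝ} {M M' : ℝ}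
    (hv : IsBoundedL1Curve v M) (hw : IsBoundedL1Curve w M') {a : EuclideanSpace ℝ (Fin N)}
    (heq : ∀ φ : ℝ → EuclideanSpace ℝ (Fin N) → ℝ, IsParabolicTest φ →
      ∫ t in Ioi (0 : ℝ), ∫ x, v t x *
        (deriv (fun s => φ s x) t + Laplacian.laplacian (φ t) x) =
      ∫ t in Ioi (0 : ℝ), ∫ x, w t x * fderiv ℝ (φ t) x a)
    (hk : IsTestFunction k) (x : EuclideanSpace ℝ (Fin N)) {t : ℝ} (ht : 0 < t) :
    HasDerivAt (fun s => mollify k (v s) x) (mollifiedRHS a k (v t) (w t) x) t := by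
  have hrhs : Continuous fun s => mollifiedRHS a k (v s) (w s) x :=
    (hv.continuous_mollifiedRHS hw hk a).comp (Continuous.prodMk_left x)
  refine HasWeakDerivOnPos.hasDerivAt (h := fun s => mollifiedRHS a k (v s) (w s) x)
    (fun χ hχ hχ0 => ?_) (hv.continuous_mollify_left hk x) hrhs ht
  have hlin : Integrable fun s => deriv χ s * mollify k (v s) x +
      χ s * mollify (Laplacian.laplacian k) (v s) x :=
    (((hχ.contDiff.continuous_deriv (by simp)).mul
      (hv.continuous_mollify_left hk x)).integrable_of_hasCompactSupport
      hχ.hasCompactSupport.deriv.mul_right).add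
    ((hχ.continuous.mul (hv.continuous_mollify_left hk.laplacian x)).integrable_of_hasCompactSupport
      hχ.hasCompactSupport.mul_right)
  have hflux : Integrable fun s => χ s * mollify (fun z => fderiv ℝ k z a) (w s) x :=
    (hχ.continuous.mul (hw.continuous_mollify_left
      (hk.fderiv_apply a) x)).integrable_of_hasCompactSupport hχ.hasCompactSupport.mul_right
  have htest := heq _ (hχ.isParabolicTest_mul hχ0 (hk.comp_sub_left x))
  simp only [hχ.integral_mul_deriv_add_laplacian hk (hv.integrable _),
    hk.integral_mul_fderiv_const_mul] at htest
  rw [integral_neg, ← add_eq_zero_iff_eq_neg,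
    ← integral_add hlin.integrableOn hflux.integrableOn] at htest
  simpa only [mollifiedRHS, mul_add, add_assoc] using htest

end MollifiedEquation

/-- A bounded `L¹`-continuous curve `v` all of whose mollifications solve the mollified equation
`∂ₜ(k ∗ v) = Δ(k ∗ v) + a · ∇(k ∗ F(v))` for `t > 0`, where `F` is `K`-Lipschitz on the range
`[-M, M]` of `v`. -/
structure IsMollifiedSolution {E : Type*} [NormedAddCommGroup E] [InnerProductSpace ℝ E]
    [FiniteDimensional ℝ E] [MeasurableSpace E] [BorelSpace E] (a : E) (F : ℝ → ℝ)
    (v : ℝ → E → ℝ) (M : ℝ) (K : NNReal) : Prop where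
  curve : IsBoundedL1Curve v M
  continuous_flux : Continuous F
  flux_zero : F 0 = 0
  lipschitz : LipschitzOnWith K F (Icc (-M) M)
  hasDerivAt : ∀ k : E → ℝ, IsTestFunction k → ∀ x t, 0 < t →
    HasDerivAt (fun s => mollify k (v s) x) (mollifiedRHS a k (v t) (fun x => F (v t x)) x) t

section Energy

open scoped NNReal

/-- `J` is a convex entropy vanishing at `0`, with first derivative `p` and continuous second
derivative `q`. -/
structure IsEntropy (J p q : ℝ → ℝ) : Prop where
  zero : J 0 = 0
  hasDerivAt : ∀ s, HasDerivAt J (p s) s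
  hasDerivAt_deriv : ∀ s, HasDerivAt p (q s) s
  continuous_deriv_deriv : Continuous q
  deriv_deriv_nonneg : ∀ s, 0 ≤ q s

namespace IsEntropy

variable {J p q : ℝ → ℝ}

theorem continuous (hJ : IsEntropy J p q) : Continuous J :=
  continuous_iff_continuousAt.2 fun s => (hJ.hasDerivAt s).continuousAt

theorem continuous_deriv (hJ : IsEntropy J p q) : Continuous p :=
  continuous_iff_continuousAt.2 fun s => (hJ.hasDerivAt_deriv s).continuousAt

theorem exists_lipschitzOnWith (hJ : IsEntropy J p q) (M : ℝ) :
    ∃ C : ℝ≥0, (∀ s ∈ Icc (-M) M, ‖p s‖ ≤ C) ∧ LipschitzOnWith C J (Icc (-M) M) := by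
  obtain ⟨C, hC⟩ := (isCompact_Icc (a := -M) (b := M)).exists_bound_of_continuousOn
    hJ.continuous_deriv.continuousOn
  have hbound (s : ℝ) (hs : s ∈ Icc (-M) M) : ‖p s‖ ≤ C.toNNReal :=
    (hC s hs).trans (Real.le_coe_toNNReal C)
  exact ⟨C.toNNReal, hbound, (convex_Icc (-M) M).lipschitzOnWith_of_nnnorm_hasDerivWithin_le
    (fun s _ => (hJ.hasDerivAt s).hasDerivWithinAt) hbound⟩

end IsEntropy

variable {E : Type*} [NormedAddCommGroup E] [InnerProductSpace ℝ E] [FiniteDimensional ℝ E]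
  [MeasurableSpace E] [BorelSpace E]

/-- The commutator `k ∗ F(f) - F(k ∗ f)` between mollification and the flux. -/
noncomputable def mollifyCommutator (F : ℝ → ℝ) (k f : E → ℝ) (x : E) : ℝ :=
  mollify k (fun y => F (f y)) x - F (mollify k f x)

namespace IsMollifiedSolution

variable {a : E} {F : ℝ → ℝ} {v : ℝ → E → ℝ} {M : ℝ} {K : ℝ≥0} {k : E → ℝ} {J p q w w' : ℝ → ℝ}

theorem flux_curve (h : IsMollifiedSolution a F v M K) :
    IsBoundedL1Curve (fun t x => F (v t x)) (K * M) :=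
  h.curve.comp h.continuous_flux h.flux_zero h.lipschitz

theorem integrable_comp (h : IsMollifiedSolution a F v M K) (hJ : IsEntropy J p q) (t : ℝ) :
    Integrable fun x => J (v t x) := by
  obtain ⟨C, -, hC⟩ := hJ.exists_lipschitzOnWith M
  exact (h.curve.comp hJ.continuous hJ.zero hC).integrable t

theorem integrable_comp_mollify (h : IsMollifiedSolution a F v M K) (hJ : IsEntropy J p q)
    (hk : IsMollifier k) (t : ℝ) : Integrable fun x => J (mollify k (v t) x) := by
  obtain ⟨C, -, hC⟩ := hJ.exists_lipschitzOnWith M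
  exact ((h.curve.mollified_of_isMollifier hk).comp hJ.continuous hJ.zero hC).integrable t

theorem integrable_comp_mollify_mul_rhs (h : IsMollifiedSolution a F v M K) (hp : Continuous p)
    (hk : IsTestFunction k) (t : ℝ) : Integrable fun x =>
      p (mollify k (v t) x) * mollifiedRHS a k (v t) (fun x => F (v t x)) x :=
  hk.integrable_comp_mollify_mul hp (h.curve.integrable t)
    (hk.integrable_mollifiedRHS (h.curve.integrable t) (h.flux_curve.integrable t) a)

theorem integrable_prod_energyRate (h : IsMollifiedSolution a F v M K) (hJ : IsEntropy J p q)
    (hk : IsMollifier k) (hw : Continuous w) (hw' : Continuous w') (t : ℝ) :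
    Integrable (fun q : ℝ × E => w' q.1 * J (mollify k (v q.1) q.2) + w q.1 *
      (p (mollify k (v q.1) q.2) * mollifiedRHS a k (v q.1) (fun x => F (v q.1 x)) q.2))
      ((volume.restrict (Ioc 0 t)).prod volume) := by
  have hkt := hk.toIsTestFunction
  obtain ⟨C, hC, hJC⟩ := hJ.exists_lipschitzOnWith M
  have hvk := h.curve.mollified_of_isMollifier hk
  have hvk_cont := h.curve.continuous_mollify hkt
  have hJint := (hvk.comp hJ.continuous hJ.zero hJC).integrable_prod_mul
    (hJ.continuous.comp hvk_cont) hw' t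
  have hRint := ((h.curve.mollified hkt.laplacian).integrable_prod_mul
      (h.curve.continuous_mollify hkt.laplacian) hw t).add
    ((h.flux_curve.mollified (hkt.fderiv_apply a)).integrable_prod_mul
      (h.flux_curve.continuous_mollify (hkt.fderiv_apply a)) hw t)
  have hpRint := hRint.bdd_mul (hJ.continuous_deriv.comp hvk_cont).aestronglyMeasurable
    (Eventually.of_forall fun q => hC _ (abs_le.1 (hvk.abs_le q.1 q.2)))
  refine (hJint.add hpRint).congr (Eventually.of_forall fun q => ?_)
  simp only [Pi.add_apply, Function.comp_apply, mollifiedRHS]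
  ring

theorem integral_energyRate (h : IsMollifiedSolution a F v M K) (hJ : IsEntropy J p q)
    (hk : IsMollifier k) (hw : ∀ s, HasDerivAt w (w' s) s) (hw' : Continuous w') {t : ℝ}
    (ht : 0 ≤ t) (x : E) :
    ∫ τ in Ioc 0 t, (w' τ * J (mollify k (v τ) x) + w τ *
      (p (mollify k (v τ) x) * mollifiedRHS a k (v τ) (fun x => F (v τ x)) x)) =
      w t * J (mollify k (v t) x) - w 0 * J (mollify k (v 0) x) := by
  have hkt := hk.toIsTestFunction
  have hwc : Continuous w := continuous_iff_continuousAt.2 fun s => (hw s).continuousAt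
  have hvk := h.curve.continuous_mollify_left hkt x
  have hrhs : Continuous fun τ => mollifiedRHS a k (v τ) (fun x => F (v τ x)) x :=
    (h.curve.continuous_mollifiedRHS h.flux_curve hkt a).comp (Continuous.prodMk_left x)
  rw [← intervalIntegral.integral_of_le ht]
  refine intervalIntegral.integral_eq_sub_of_hasDerivAt_of_le ht
    (f := fun τ => w τ * J (mollify k (v τ) x))
    (hwc.mul (hJ.continuous.comp hvk)).continuousOn (fun τ hτ => ?_)
    (((hw'.mul (hJ.continuous.comp hvk)).add
      (hwc.mul ((hJ.continuous_deriv.comp hvk).mul hrhs))).intervalIntegrable _ _)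
  exact (hw τ).mul ((hJ.hasDerivAt _).comp τ (h.hasDerivAt k hkt x τ hτ.1))

theorem energy_identity (h : IsMollifiedSolution a F v M K) (hJ : IsEntropy J p q)
    (hk : IsMollifier k) (hw : ∀ s, HasDerivAt w (w' s) s) (hw' : Continuous w') {t : ℝ}
    (ht : 0 ≤ t) :
    IntegrableOn (fun τ => w' τ * (∫ x, J (mollify k (v τ) x)) + w τ *
      ∫ x, p (mollify k (v τ) x) * mollifiedRHS a k (v τ) (fun x => F (v τ x)) x) (Ioc 0 t) ∧
    w t * (∫ x, J (mollify k (v t) x)) - w 0 * (∫ x, J (mollify k (v 0) x)) =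
      ∫ τ in Ioc 0 t, (w' τ * (∫ x, J (mollify k (v τ) x)) + w τ *
        ∫ x, p (mollify k (v τ) x) * mollifiedRHS a k (v τ) (fun x => F (v τ x)) x) := by
  have hwc : Continuous w := continuous_iff_continuousAt.2 fun s => (hw s).continuousAt
  have hJint := h.integrable_comp_mollify hJ hk
  have hpRint := h.integrable_comp_mollify_mul_rhs hJ.continuous_deriv hk.toIsTestFunction
  have hprod := h.integrable_prod_energyRate hJ hk hwc hw' t
  have hspace (τ : ℝ) : ∫ x, (w' τ * J (mollify k (v τ) x) + w τ *
      (p (mollify k (v τ) x) * mollifiedRHS a k (v τ) (fun x => F (v τ x)) x)) =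
      w' τ * (∫ x, J (mollify k (v τ) x)) + w τ *
        ∫ x, p (mollify k (v τ) x) * mollifiedRHS a k (v τ) (fun x => F (v τ x)) x := by
    rw [integral_add ((hJint τ).const_mul _) ((hpRint τ).const_mul _), integral_const_mul,
      integral_const_mul]
  simp only [← hspace]
  refine ⟨hprod.integral_prod_left, ?_⟩
  rw [integral_integral_swap hprod, ← integral_const_mul, ← integral_const_mul,
    ← integral_sub ((hJint t).const_mul _) ((hJint 0).const_mul _)]
  exact integral_congr_ae (Eventually.of_forall fun x =>
    (h.integral_energyRate hJ hk hw hw' ht x).symm)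

theorem commutator_curve (h : IsMollifiedSolution a F v M K) (hk : IsMollifier k) :
    IsBoundedL1Curve (fun t => mollifyCommutator F k (v t)) (K * M + K * M) :=
  (h.flux_curve.mollified_of_isMollifier hk).sub
    ((h.curve.mollified_of_isMollifier hk).comp h.continuous_flux h.flux_zero h.lipschitz)

theorem integrable_sq_commutator (h : IsMollifiedSolution a F v M K) (hk : IsMollifier k) (t : ℝ) :
    Integrable (fun x => mollifyCommutator F k (v t) x ^ 2) ∧
      ∫ x, mollifyCommutator F k (v t) x ^ 2 ≤
        (K * M + K * M) * ∫ x, |mollifyCommutator F k (v t) x| := by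
  have hc := h.commutator_curve hk
  have hle (x : E) : mollifyCommutator F k (v t) x ^ 2 ≤
      (K * M + K * M) * |mollifyCommutator F k (v t) x| := by
    rw [← sq_abs, sq]
    exact mul_le_mul_of_nonneg_right (hc.abs_le t x) (abs_nonneg _)
  have hbound : Integrable fun x => (K * M + K * M) * |mollifyCommutator F k (v t) x| :=
    (hc.integrable t).abs.const_mul _
  have hsq : Integrable fun x => mollifyCommutator F k (v t) x ^ 2 :=
    hbound.mono' ((hc.measurable t).pow_const 2).aestronglyMeasurable
      (Eventually.of_forall fun x => (Real.norm_of_nonneg (sq_nonneg _)).trans_le (hle x))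
  rw [← integral_const_mul]
  exact ⟨hsq, integral_mono hsq hbound hle⟩

theorem integral_abs_commutator_le (h : IsMollifiedSolution a F v M K) (hk : IsMollifier k)
    (t : ℝ) : ∫ x, |mollifyCommutator F k (v t) x| ≤
      (∫ x, |F (v t x)|) + K * ∫ x, |v t x| := by
  have hvk := h.curve.mollified_of_isMollifier hk
  have hFk := ((h.flux_curve.mollified_of_isMollifier hk).integrable t).abs
  have hkF := (hvk.integrable t).abs.const_mul (K : ℝ)
  calc ∫ x, |mollifyCommutator F k (v t) x|
      ≤ ∫ x, (|mollify k (fun x => F (v t x)) x| + K * |mollify k (v t) x|) :=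
        integral_mono ((h.commutator_curve hk).integrable t).abs (hFk.add hkF) fun x =>
          (abs_sub _ _).trans (add_le_add le_rfl (hvk.abs_comp_le h.flux_zero h.lipschitz t x))
    _ = (∫ x, |mollify k (fun x => F (v t x)) x|) + K * ∫ x, |mollify k (v t) x| := by
        rw [integral_add hFk hkF, integral_const_mul]
    _ ≤ (∫ x, |F (v t x)|) + K * ∫ x, |v t x| := by
        exact add_le_add (hk.integral_abs_mollify_le (h.flux_curve.integrable t))
          (mul_le_mul_of_nonneg_left (hk.integral_abs_mollify_le (h.curve.integrable t)) K.2)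

theorem tendsto_integral_abs_commutator (h : IsMollifiedSolution a F v M K) {k : ℕ → E → ℝ}
    (hk : ∀ n, IsMollifier (k n)) (hlim : ∀ f : E → ℝ, Integrable f →
      Tendsto (fun n => ∫ x, |mollify (k n) f x - f x|) atTop (𝓝 0)) (t : ℝ) :
    Tendsto (fun n => ∫ x, |mollifyCommutator F (k n) (v t) x|) atTop (𝓝 0) := by
  have hbound := (hlim _ (h.flux_curve.integrable t)).add
    ((hlim _ (h.curve.integrable t)).const_mul (K : ℝ))
  rw [mul_zero, add_zero] at hbound
  refine squeeze_zero (fun n => integral_nonneg fun x => abs_nonneg _) (fun n => ?_) hbound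
  have hvk := h.curve.mollified_of_isMollifier (hk n)
  have hFk : Integrable fun x => |mollify (k n) (fun x => F (v t x)) x - F (v t x)| :=
    (((h.flux_curve.mollified_of_isMollifier (hk n)).integrable t).sub
      (h.flux_curve.integrable t)).abs
  have hkF : Integrable fun x => K * |mollify (k n) (v t) x - v t x| :=
    ((hvk.integrable t).sub (h.curve.integrable t)).abs.const_mul _
  rw [← integral_const_mul, ← integral_add hFk hkF]
  refine integral_mono ((h.commutator_curve (hk n)).integrable t).abs (hFk.add hkF) fun x => ?_
  refine (abs_sub_le _ (F (v t x)) _).trans (add_le_add le_rfl ?_)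
  rw [abs_sub_comm]
  exact h.lipschitz.norm_sub_le (hvk.mem_Icc t x) (h.curve.mem_Icc t x)

theorem tendsto_setIntegral_abs_commutator (h : IsMollifiedSolution a F v M K) {k : ℕ → E → ℝ}
    (hk : ∀ n, IsMollifier (k n)) (hlim : ∀ f : E → ℝ, Integrable f →
      Tendsto (fun n => ∫ x, |mollify (k n) f x - f x|) atTop (𝓝 0)) (t : ℝ) :
    Tendsto (fun n => ∫ s in Ioc 0 t, ∫ x, |mollifyCommutator F (k n) (v s) x|) atTop (𝓝 0) := by
  have hbound : Continuous fun s => (∫ x, |F (v s x)|) + K * ∫ x, |v s x| :=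
    h.flux_curve.continuous_integral_abs.add
      (continuous_const.mul h.curve.continuous_integral_abs)
  have hbound_int : IntegrableOn (fun s => (∫ x, |F (v s x)|) + K * ∫ x, |v s x|) (Ioc 0 t) :=
    hbound.integrableOn_Icc.mono_set Ioc_subset_Icc_self
  suffices Tendsto (fun n => ∫ s in Ioc 0 t, ∫ x, |mollifyCommutator F (k n) (v s) x|) atTop
      (𝓝 (∫ _ in Ioc 0 t, (0 : ℝ))) by rwa [integral_zero] at this
  refine tendsto_integral_of_dominated_convergence _
    (fun n => ((h.commutator_curve (hk n)).continuous_integral_abs).aestronglyMeasurable) hbound_int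
    (fun n => Eventually.of_forall fun s => ?_)
    (Eventually.of_forall fun s => h.tendsto_integral_abs_commutator hk hlim s)
  rw [Real.norm_of_nonneg (integral_nonneg fun x => abs_nonneg _)]
  exact h.integral_abs_commutator_le (hk n) s

theorem tendsto_integral_comp_mollify (h : IsMollifiedSolution a F v M K) (hJ : IsEntropy J p q)
    {k : ℕ → E → ℝ} (hk : ∀ n, IsMollifier (k n)) (hlim : ∀ f : E → ℝ, Integrable f →
      Tendsto (fun n => ∫ x, |mollify (k n) f x - f x|) atTop (𝓝 0)) (t : ℝ) :
    Tendsto (fun n => ∫ x, J (mollify (k n) (v t) x)) atTop (𝓝 (∫ x, J (v t x))) := by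
  obtain ⟨C, -, hC⟩ := hJ.exists_lipschitzOnWith M
  have hbound := (hlim _ (h.curve.integrable t)).const_mul (C : ℝ)
  rw [mul_zero] at hbound
  refine tendsto_iff_dist_tendsto_zero.2 (squeeze_zero (fun _ => dist_nonneg) (fun n => ?_) hbound)
  have hJk := h.integrable_comp_mollify hJ (hk n) t
  have hJv := h.integrable_comp hJ t
  have hvk := h.curve.mollified_of_isMollifier (hk n)
  rw [Real.dist_eq, ← integral_sub hJk hJv, ← integral_const_mul]
  exact abs_integral_le_integral_abs.trans (integral_mono (hJk.sub hJv).abs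
    (((hvk.integrable t).sub (h.curve.integrable t)).abs.const_mul _) fun x =>
      hC.norm_sub_le (hvk.mem_Icc t x) (h.curve.mem_Icc t x))

theorem mollified_energy_le (h : IsMollifiedSolution a F v M K) (hJ : IsEntropy J p q)
    (hk : IsMollifier k) {L : ℝ} (hL : ∀ s, |s| ≤ M → q s ≤ L)
    (hw : ∀ s, HasDerivAt w (w' s) s) (hw' : Continuous w') {t W : ℝ} (ht : 0 ≤ t)
    (hw0 : ∀ s ∈ Ioc 0 t, 0 ≤ w s) (hW : ∀ s ∈ Ioc 0 t, w s ≤ W)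
    {b : ℝ → ℝ} (hbi : IntegrableOn b (Ioc 0 t))
    (hb : ∀ s ∈ Ioc 0 t, w' s * (∫ x, J (mollify k (v s) x)) - w s / 2 *
      (∫ x, q (mollify k (v s) x) * ‖fderiv ℝ (mollify k (v s)) x‖ ^ 2) ≤ b s) :
    w t * (∫ x, J (mollify k (v t) x)) - w 0 * (∫ x, J (mollify k (v 0) x)) ≤
      (∫ s in Ioc 0 t, b s) + W * (L * ‖a‖ ^ 2 / 2 * (K * M + K * M)) *
        ∫ s in Ioc 0 t, ∫ x, |mollifyCommutator F k (v s) x| := by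
  obtain ⟨hrate, hidentity⟩ := h.energy_identity hJ hk hw hw' ht
  have hcomm : IntegrableOn (fun s => ∫ x, |mollifyCommutator F k (v s) x|) (Ioc 0 t) :=
    (h.commutator_curve hk).continuous_integral_abs.integrableOn_Icc.mono_set Ioc_subset_Icc_self
  have hL0 : 0 ≤ L := (hJ.deriv_deriv_nonneg 0).trans
    (hL 0 (abs_zero.trans_le h.curve.nonneg))
  rw [hidentity, ← integral_const_mul, ← integral_add hbi (hcomm.const_mul _)]
  refine setIntegral_mono_on hrate (hbi.add (hcomm.const_mul _)) measurableSet_Ioc fun s hs => ?_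
  obtain ⟨hsq, hsq_le⟩ := h.integrable_sq_commutator hk s
  have hdissipation := hk.integral_comp_mollify_mul_rhs_le (h.curve.integrable s)
    (h.flux_curve.integrable s) hJ.hasDerivAt_deriv hJ.continuous_deriv_deriv
    hJ.deriv_deriv_nonneg h.continuous_flux (h.curve.abs_le s) hL a hsq
  have hweighted := mul_le_mul_of_nonneg_left hdissipation (hw0 s hs)
  have herror : w s * (L * ‖a‖ ^ 2 / 2 * ∫ x, mollifyCommutator F k (v s) x ^ 2) ≤
      W * (L * ‖a‖ ^ 2 / 2 *
        ((K * M + K * M) * ∫ x, |mollifyCommutator F k (v s) x|)) :=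
    mul_le_mul (hW s hs) (mul_le_mul_of_nonneg_left hsq_le (by positivity))
      (mul_nonneg (by positivity) (integral_nonneg fun x => sq_nonneg _))
      ((hw0 s hs).trans (hW s hs))
  unfold mollifyCommutator at herror ⊢
  linarith [hb s hs]

theorem energy_le (h : IsMollifiedSolution a F v M K) (hJ : IsEntropy J p q)
    (hw : ∀ s, HasDerivAt w (w' s) s) (hw' : Continuous w') {t : ℝ} (ht : 0 ≤ t)
    (hw0 : ∀ s ∈ Ioc 0 t, 0 ≤ w s) {b : ℝ → ℝ} (hbi : IntegrableOn b (Ioc 0 t))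
    (hb : ∀ k : E → ℝ, IsMollifier k → ∀ s ∈ Ioc 0 t,
      w' s * (∫ x, J (mollify k (v s) x)) - w s / 2 *
      (∫ x, q (mollify k (v s) x) * ‖fderiv ℝ (mollify k (v s)) x‖ ^ 2) ≤ b s) :
    w t * (∫ x, J (v t x)) - w 0 * (∫ x, J (v 0 x)) ≤ ∫ s in Ioc 0 t, b s := by
  obtain ⟨k, hk, hlim⟩ := exists_isMollifier_tendsto E
  have hwc : Continuous w := continuous_iff_continuousAt.2 fun s => (hw s).continuousAt
  obtain ⟨L, hL⟩ := (isCompact_Icc (a := -M) (b := M)).exists_bound_of_continuousOn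
    hJ.continuous_deriv_deriv.continuousOn
  obtain ⟨W, hW⟩ := (isCompact_Icc (a := 0) (b := t)).exists_bound_of_continuousOn hwc.continuousOn
  have hJlim := h.tendsto_integral_comp_mollify hJ hk hlim
  have herror := ((h.tendsto_setIntegral_abs_commutator hk hlim t).const_mul
    (W * (L * ‖a‖ ^ 2 / 2 * (K * M + K * M)))).const_add (∫ s in Ioc 0 t, b s)
  rw [mul_zero, add_zero] at herror
  exact le_of_tendsto_of_tendsto' (((hJlim t).const_mul (w t)).sub ((hJlim 0).const_mul (w 0)))
    herror fun n => h.mollified_energy_le hJ (hk n)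
      (fun s hs => (le_abs_self _).trans (hL s (abs_le.1 hs))) hw hw' ht hw0
      (fun s hs => (le_abs_self _).trans (hW s (Ioc_subset_Icc_self hs))) hbi (hb _ (hk n))

end IsMollifiedSolution

end Energy

section Contraction

theorem isEntropy_sqrt_sq_add_sq {η : ℝ} (hη : 0 < η) :
    IsEntropy (fun s => √(s ^ 2 + η ^ 2) - η) (fun s => s / √(s ^ 2 + η ^ 2))
      (fun s => η ^ 2 / √(s ^ 2 + η ^ 2) ^ 3) := by
  have hpos (s : ℝ) : 0 < s ^ 2 + η ^ 2 := by positivity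
  have hroot (s : ℝ) : 0 < √(s ^ 2 + η ^ 2) := Real.sqrt_pos.2 (hpos s)
  have hderiv (s : ℝ) :
      HasDerivAt (fun s => √(s ^ 2 + η ^ 2)) (s / √(s ^ 2 + η ^ 2)) s := by
    have hsq : HasDerivAt (fun s : ℝ => s ^ 2 + η ^ 2) (2 * s) s := by
      simpa using (hasDerivAt_pow 2 s).add_const (η ^ 2)
    convert! hsq.sqrt (hpos s).ne' using 1
    ring
  refine ⟨by simp [Real.sqrt_sq hη.le], fun s => (hderiv s).sub_const η, fun s => ?_,
    continuous_const.div (by fun_prop) fun s => (pow_pos (hroot s) 3).ne', fun s => by positivity⟩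
  convert! (hasDerivAt_id s).div (hderiv s) (hroot s).ne' using 1
  have hη_sq : η ^ 2 = √(s ^ 2 + η ^ 2) ^ 2 - s ^ 2 := by rw [Real.sq_sqrt (hpos s).le]; ring
  have hroot_ne := (hroot s).ne'
  simp only [id]
  set S := √(s ^ 2 + η ^ 2)
  rw [hη_sq]
  field_simp

theorem sqrt_sq_add_sq_sub_nonneg (s η : ℝ) : 0 ≤ √(s ^ 2 + η ^ 2) - η :=
  sub_nonneg.2 (Real.le_sqrt_of_sq_le (le_add_of_nonneg_left (sq_nonneg s)))

theorem sqrt_sq_add_sq_sub_le_abs (s : ℝ) {η : ℝ} (hη : 0 ≤ η) : √(s ^ 2 + η ^ 2) - η ≤ |s| := by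
  refine sub_le_iff_le_add.2 (Real.sqrt_le_iff.2 ⟨add_nonneg (abs_nonneg s) hη, ?_⟩)
  rw [add_sq, sq_abs]
  linarith [mul_nonneg (abs_nonneg s) hη]

theorem tendsto_sqrt_sq_add_sq_sub (s : ℝ) :
    Tendsto (fun η => √(s ^ 2 + η ^ 2) - η) (𝓝 0) (𝓝 |s|) := by
  have hcont : Continuous fun η => √(s ^ 2 + η ^ 2) - η := by fun_prop
  simpa [Real.sqrt_sq_eq_abs] using hcont.tendsto 0

variable {E : Type*} [NormedAddCommGroup E] [InnerProductSpace ℝ E] [FiniteDimensional ℝ E]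
  [MeasurableSpace E] [BorelSpace E]

namespace IsMollifiedSolution

variable {a : E} {F : ℝ → ℝ} {v : ℝ → E → ℝ} {M : ℝ} {K : NNReal} {J p q : ℝ → ℝ} {t : ℝ}

theorem integral_comp_le (h : IsMollifiedSolution a F v M K) (hJ : IsEntropy J p q) (ht : 0 ≤ t) :
    ∫ x, J (v t x) ≤ ∫ x, J (v 0 x) := by
  have henergy := h.energy_le (w := fun _ => 1) (w' := fun _ => 0) (b := fun _ => 0) hJ
    (fun s => hasDerivAt_const s 1) continuous_const ht (fun s _ => zero_le_one) integrableOn_zero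
    fun k _ s _ => by
      have hdissipation : 0 ≤ ∫ x, q (mollify k (v s) x) * ‖fderiv ℝ (mollify k (v s)) x‖ ^ 2 :=
        integral_nonneg fun x => mul_nonneg (hJ.deriv_deriv_nonneg _) (sq_nonneg _)
      linarith
  simpa using henergy

theorem integral_abs_le (h : IsMollifiedSolution a F v M K) (ht : 0 ≤ t) :
    ∫ x, |v t x| ≤ ∫ x, |v 0 x| := by
  have hentropy (n : ℕ) := isEntropy_sqrt_sq_add_sq (η := 1 / (n + 1 : ℝ)) (by positivity)
  have hnorm (n : ℕ) (s : ℝ) :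
      ‖√(s ^ 2 + (1 / (n + 1 : ℝ)) ^ 2) - 1 / (n + 1 : ℝ)‖ ≤ |s| :=
    (Real.norm_of_nonneg (sqrt_sq_add_sq_sub_nonneg s _)).trans_le
      (sqrt_sq_add_sq_sub_le_abs s (by positivity))
  have hlim : Tendsto (fun n : ℕ => ∫ x, (√(v t x ^ 2 + (1 / (n + 1 : ℝ)) ^ 2) - 1 / (n + 1 : ℝ)))
      atTop (𝓝 (∫ x, |v t x|)) :=
    tendsto_integral_of_dominated_convergence _
      (fun n => (h.integrable_comp (hentropy n) t).aestronglyMeasurable)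
      (h.curve.integrable t).abs (fun n => Eventually.of_forall fun x => hnorm n _)
      (Eventually.of_forall fun x =>
        (tendsto_sqrt_sq_add_sq_sub (v t x)).comp tendsto_one_div_add_atTop_nhds_zero_nat)
  refine le_of_tendsto' hlim fun n => (h.integral_comp_le (hentropy n) ht).trans ?_
  exact integral_mono (h.integrable_comp (hentropy n) 0) (h.curve.integrable 0).abs
    fun x => (le_abs_self _).trans (hnorm n _)

end IsMollifiedSolution

end Contraction

section Moments

open Module (finrank)

theorem integrable_abs_pow_succ {α : Type*} [MeasurableSpace α] {μ : Measure α} {f : α → ℝ} {M : ℝ}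
    (hf : Integrable f μ) (hM : ∀ x, |f x| ≤ M) (n : ℕ) :
    Integrable (fun x => |f x| ^ (n + 1)) μ := by
  simp only [pow_succ]
  refine hf.abs.bdd_mul (hf.abs.aestronglyMeasurable.pow n) (c := M ^ n)
    (Eventually.of_forall fun x => ?_)
  rw [norm_pow, Real.norm_eq_abs, abs_abs]
  exact pow_le_pow_left₀ (abs_nonneg _) (hM x) n

theorem isEntropy_pow (n : ℕ) :
    IsEntropy (fun s => s ^ (2 * n + 2)) (fun s => (2 * n + 2) * s ^ (2 * n + 1))
      (fun s => (2 * n + 2) * ((2 * n + 1) * s ^ (2 * n))) where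
  zero := by simp
  hasDerivAt s := by simpa using hasDerivAt_pow (2 * n + 2) s
  hasDerivAt_deriv s := by
    simpa using (hasDerivAt_pow (2 * n + 1) s).const_mul (2 * (n : ℝ) + 2)
  continuous_deriv_deriv := by fun_prop
  deriv_deriv_nonneg s := by have := (even_two_mul n).pow_nonneg s; positivity

variable {E : Type*} [NormedAddCommGroup E] [InnerProductSpace ℝ E] [FiniteDimensional ℝ E]
  [MeasurableSpace E] [BorelSpace E] {k f : E → ℝ} {M : ℝ}

theorem IsTestFunction.norm_fderiv_mollify_pow_sq (hk : IsTestFunction k) (hf : Integrable f)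
    (n : ℕ) (x : E) :
    ‖fderiv ℝ (fun x => mollify k f x ^ (n + 1)) x‖ ^ 2 =
      (n + 1) ^ 2 * mollify k f x ^ (2 * n) * ‖fderiv ℝ (mollify k f) x‖ ^ 2 := by
  have hderiv := ((hk.differentiable_mollify hf x).hasFDerivAt.pow (n + 1)).fderiv
  simp only [add_tsub_cancel_right, nsmul_eq_mul, Nat.cast_add, Nat.cast_one] at hderiv
  rw [hderiv, norm_smul, mul_pow, Real.norm_eq_abs, sq_abs]
  ring

theorem IsTestFunction.integral_norm_fderiv_mollify_pow_sq_le (hk : IsTestFunction k)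
    (hf : Integrable f) (n : ℕ) :
    Integrable (fun x => ‖fderiv ℝ (fun x => mollify k f x ^ (n + 1)) x‖ ^ 2) ∧
      2 * ∫ x, ‖fderiv ℝ (fun x => mollify k f x ^ (n + 1)) x‖ ^ 2 ≤
        ∫ x, ((2 * n + 2) * ((2 * n + 1) * mollify k f x ^ (2 * n))) *
          ‖fderiv ℝ (mollify k f) x‖ ^ 2 := by
  have hgrad := hk.integrable_norm_fderiv_mollify_sq hf
  have hpow : Integrable fun x => ‖fderiv ℝ (fun x => mollify k f x ^ (n + 1)) x‖ ^ 2 := by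
    simp only [hk.norm_fderiv_mollify_pow_sq hf]
    exact hk.integrable_comp_mollify_mul (p := fun s => ((n : ℝ) + 1) ^ 2 * s ^ (2 * n))
      (by fun_prop) hf hgrad
  have hdissipation := hk.integrable_comp_mollify_mul (isEntropy_pow n).continuous_deriv_deriv
    hf hgrad
  refine ⟨hpow, ?_⟩
  rw [← integral_const_mul]
  refine integral_mono (hpow.const_mul 2) hdissipation fun x => ?_
  have hnonneg : 0 ≤ mollify k f x ^ (2 * n) * ‖fderiv ℝ (mollify k f) x‖ ^ 2 :=
    mul_nonneg ((even_two_mul n).pow_nonneg _) (sq_nonneg _)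
  have hgap : 0 ≤ (2 * n * (n + 1) : ℝ) *
      (mollify k f x ^ (2 * n) * ‖fderiv ℝ (mollify k f) x‖ ^ 2) := by positivity
  simp only [hk.norm_fderiv_mollify_pow_sq hf]
  linarith

theorem IsMollifier.integral_abs_mollify_pow_le (hk : IsMollifier k) (hf : Integrable f)
    (hM : ∀ x, |f x| ≤ M) (n : ℕ) :
    ∫ x, |mollify k f x| ^ (n + 1) ≤ ∫ x, |f x| ^ (n + 1) := by
  have hconvex : ConvexOn ℝ univ fun s : ℝ => |s| ^ (n + 1) :=
    (convexOn_norm convex_univ).pow (fun s _ => norm_nonneg s) (n + 1)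
  exact hk.integral_comp_mollify_le hconvex hf (integrable_abs_pow_succ hf hM n)
    (integrable_abs_pow_succ (hk.integrable_mollify hf) (hk.abs_mollify_le hM) n)

theorem IsMollifier.integral_mollify_pow_le (hk : IsMollifier k) (hf : Integrable f)
    (hM : ∀ x, |f x| ≤ M) (n : ℕ) {r : ℝ} (hr : 0 < r) :
    ∫ x, mollify k f x ^ (2 * n + 2) ≤ r ^ 2 / 4 *
      (∫ x, ((2 * n + 2) * ((2 * n + 1) * mollify k f x ^ (2 * n))) *
        ‖fderiv ℝ (mollify k f) x‖ ^ 2) +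
      (∫ x, |f x| ^ (n + 1)) ^ 2 / (r ^ finrank ℝ E * volume.real (Metric.ball (0 : E) 1)) := by
  have hU := hk.integrable_mollify hf
  have hUM := hk.abs_mollify_le hM
  have hsmooth : ContDiff ℝ 1 fun x => mollify k f x ^ (n + 1) :=
    ((hk.contDiff_mollify hf).of_le (by simp)).pow (n + 1)
  have hpow : Integrable fun x => mollify k f x ^ (n + 1) := by
    refine (integrable_abs_pow_succ hU hUM n).mono hsmooth.continuous.aestronglyMeasurable
      (Eventually.of_forall fun x => ?_)
    simp
  have hsq (x : E) : (mollify k f x ^ (n + 1)) ^ 2 = mollify k f x ^ (2 * n + 2) := by ring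
  have hsq_int : Integrable fun x => (mollify k f x ^ (n + 1)) ^ 2 := by
    simp only [hsq]
    refine (integrable_abs_pow_succ hU hUM (2 * n + 1)).congr (Eventually.of_forall fun x => ?_)
    exact (even_two_mul (n + 1)).pow_abs _
  obtain ⟨hgrad, hgrad_le⟩ := hk.integral_norm_fderiv_mollify_pow_sq_le hf n
  have hball : volume.real (Metric.ball (0 : E) r) =
      r ^ finrank ℝ E * volume.real (Metric.ball (0 : E) 1) := by
    rw [measureReal_def, Measure.addHaar_ball_of_pos _ _ hr, ENNReal.toReal_mul,
      ENNReal.toReal_ofReal (by positivity), measureReal_def]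
  have hL1 : (∫ x, |mollify k f x ^ (n + 1)|) ^ 2 ≤ (∫ x, |f x| ^ (n + 1)) ^ 2 := by
    simp only [abs_pow]
    exact pow_le_pow_left₀ (integral_nonneg fun x => by positivity)
      (hk.integral_abs_mollify_pow_le hf hM n) 2
  have hnash := integral_sq_le_of_scale hsmooth hpow hsq_int hgrad hr
  simp only [hsq, hball] at hnash
  refine hnash.trans (add_le_add ?_ (div_le_div_of_nonneg_right hL1 (by positivity)))
  linarith [mul_le_mul_of_nonneg_left hgrad_le (show 0 ≤ r ^ 2 / 4 by positivity)]

theorem volume_real_unit_ball_pos : 0 < volume.real (Metric.ball (0 : E) 1) :=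
  ENNReal.toReal_pos (Metric.measure_ball_pos _ _ one_pos).ne' measure_ball_lt_top.ne

-- The length scale `r = √s / (κ + 1)` makes the dissipation absorb the derivative of the weight.
theorem IsMollifier.weighted_energyRate_le (hk : IsMollifier k) (hf : Integrable f)
    (hM : ∀ x, |f x| ≤ M) (n κ : ℕ) {s : ℝ} (hs : 0 < s) :
    (κ + 1) * s ^ κ * (∫ x, mollify k f x ^ (2 * n + 2)) - s ^ (κ + 1) / 2 *
      (∫ x, ((2 * n + 2) * ((2 * n + 1) * mollify k f x ^ (2 * n))) *
        ‖fderiv ℝ (mollify k f) x‖ ^ 2) ≤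
      (κ + 1) ^ (finrank ℝ E + 1) / volume.real (Metric.ball (0 : E) 1) *
        (s ^ κ * (∫ x, |f x| ^ (n + 1)) ^ 2 / s ^ ((finrank ℝ E : ℝ) / 2)) := by
  set d := finrank ℝ E
  set c := volume.real (Metric.ball (0 : E) 1)
  set Q := ∫ x, ((2 * n + 2) * ((2 * n + 1) * mollify k f x ^ (2 * n))) *
    ‖fderiv ℝ (mollify k f) x‖ ^ 2
  set S := ∫ x, |f x| ^ (n + 1)
  have hc : 0 < c := volume_real_unit_ball_pos
  have hQ : 0 ≤ Q := integral_nonneg fun x =>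
    mul_nonneg ((isEntropy_pow n).deriv_deriv_nonneg _) (sq_nonneg _)
  have hroot : √s ^ d = s ^ ((d : ℝ) / 2) := by
    rw [Real.sqrt_eq_rpow, ← Real.rpow_natCast, ← Real.rpow_mul hs.le]
    ring_nf
  have hnash := hk.integral_mollify_pow_le hf hM n (r := √s / (κ + 1)) (by positivity)
  rw [div_pow, div_pow, Real.sq_sqrt hs.le, hroot] at hnash
  have habsorb : (κ + 1) * s ^ κ * (s / (κ + 1) ^ 2 / 4 * Q) ≤ s ^ (κ + 1) / 2 * Q := by
    calc (κ + 1) * s ^ κ * (s / (κ + 1) ^ 2 / 4 * Q)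
        = s ^ (κ + 1) * Q / (4 * (κ + 1)) := by field_simp; ring
      _ ≤ s ^ (κ + 1) * Q / 2 :=
          div_le_div_of_nonneg_left (by positivity) two_pos
            (by linarith [κ.cast_nonneg (α := ℝ)])
      _ = s ^ (κ + 1) / 2 * Q := by ring
  have hmass : (κ + 1) * s ^ κ * (S ^ 2 / (s ^ ((d : ℝ) / 2) / (κ + 1) ^ d * c)) =
      (κ + 1) ^ (d + 1) / c * (s ^ κ * S ^ 2 / s ^ ((d : ℝ) / 2)) := by
    field_simp
    ring
  have hweighted := mul_le_mul_of_nonneg_left hnash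
    (show 0 ≤ (κ + 1) * s ^ κ by positivity)
  rw [mul_add, hmass] at hweighted
  linarith

theorem integrableOn_rpow_and_integral_eq {e t : ℝ} (he : 0 ≤ e) (ht : 0 ≤ t) :
    IntegrableOn (fun s : ℝ => s ^ e) (Ioc 0 t) ∧
      ∫ s in Ioc 0 t, s ^ e = t ^ (e + 1) / (e + 1) := by
  have he' : -1 < e := by linarith
  refine ⟨(intervalIntegrable_iff_integrableOn_Ioc_of_le ht).1
    (intervalIntegral.intervalIntegrable_rpow' he'), ?_⟩
  rw [← intervalIntegral.integral_of_le ht, integral_rpow (Or.inl he'),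
    Real.zero_rpow (by positivity), sub_zero]

namespace IsMollifiedSolution

variable {a : E} {F : ℝ → ℝ} {v : ℝ → E → ℝ} {K : NNReal}

theorem weighted_integral_pow_le (h : IsMollifiedSolution a F v M K) (n : ℕ) {A : ℝ}
    (hA : ∀ s, 0 < s → ∫ x, |v s x| ^ (n + 1) ≤ A * s ^ (-((finrank ℝ E : ℝ) / 2) * n))
    {t : ℝ} (ht : 0 < t) :
    t ^ ((finrank ℝ E + 1) * (n + 1)) * ∫ x, |v t x| ^ (2 * n + 2) ≤
      ((finrank ℝ E + 1) * (n + 1) : ℝ) ^ (finrank ℝ E + 1) /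
        volume.real (Metric.ball (0 : E) 1) * A ^ 2 *
        (t ^ ((finrank ℝ E : ℝ) / 2 + n + 1) / ((finrank ℝ E : ℝ) / 2 + n + 1)) := by
  set d := finrank ℝ E
  set c := volume.real (Metric.ball (0 : E) 1)
  obtain ⟨κ, hκ⟩ : ∃ κ, (d + 1) * (n + 1) = κ + 1 :=
    Nat.exists_eq_add_of_le' (Nat.mul_pos d.succ_pos n.succ_pos)
  have hκR : ((d + 1) * (n + 1) : ℝ) = κ + 1 := by exact_mod_cast hκ
  obtain ⟨hrpow, hrpow_eq⟩ := integrableOn_rpow_and_integral_eq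
    (show 0 ≤ (d : ℝ) / 2 + n by positivity) ht.le
  have hdecay (s : ℝ) (hs : 0 < s) :
      s ^ κ * (∫ x, |v s x| ^ (n + 1)) ^ 2 / s ^ ((d : ℝ) / 2) ≤
        A ^ 2 * s ^ ((d : ℝ) / 2 + n) := by
    have hexponent : s ^ κ * (s ^ (-((d : ℝ) / 2) * n)) ^ 2 / s ^ ((d : ℝ) / 2) =
        s ^ ((d : ℝ) / 2 + n) := by
      rw [← Real.rpow_natCast, ← Real.rpow_natCast, ← Real.rpow_mul hs.le, ← Real.rpow_add hs,
        ← Real.rpow_sub hs, eq_sub_of_add_eq hκR.symm]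
      push_cast
      ring_nf
    rw [← hexponent, ← mul_div_assoc, mul_left_comm, ← mul_pow]
    gcongr
    exact hA s hs
  have henergy := h.energy_le (isEntropy_pow n) (w := fun s => s ^ (κ + 1))
    (w' := fun s => (κ + 1) * s ^ κ)
    (b := fun s => ((κ + 1) ^ (d + 1) / c) * (A ^ 2 * s ^ ((d : ℝ) / 2 + n)))
    (fun s => by simpa using hasDerivAt_pow (κ + 1) s) (by fun_prop) ht.le
    (fun s hs => pow_nonneg hs.1.le _) ((hrpow.const_mul _).const_mul _)
    fun k hk s hs =>
      (hk.weighted_energyRate_le (h.curve.integrable s) (h.curve.abs_le s) n κ hs.1).trans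
        (mul_le_mul_of_nonneg_left (hdecay s hs.1) (by positivity))
  rw [integral_const_mul, integral_const_mul, hrpow_eq, zero_pow κ.succ_ne_zero, zero_mul,
    sub_zero, ← mul_assoc] at henergy
  have habs (x : E) : |v t x| ^ (2 * n + 2) = v t x ^ (2 * n + 2) :=
    (even_two_mul (n + 1)).pow_abs _
  simp only [habs]
  rw [hκ, hκR]
  exact henergy

theorem integral_pow_two_mul_le (h : IsMollifiedSolution a F v M K) (n : ℕ) {A : ℝ}
    (hA : ∀ s, 0 < s → ∫ x, |v s x| ^ (n + 1) ≤ A * s ^ (-((finrank ℝ E : ℝ) / 2) * n))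
    {t : ℝ} (ht : 0 < t) :
    ∫ x, |v t x| ^ (2 * n + 2) ≤
      (finrank ℝ E + 1 : ℝ) ^ (finrank ℝ E + 1) / volume.real (Metric.ball (0 : E) 1) *
        (n + 1 : ℝ) ^ finrank ℝ E * A ^ 2 * t ^ (-((finrank ℝ E : ℝ) / 2) * (2 * n + 1)) := by
  have hweighted := h.weighted_integral_pow_le n hA ht
  set d := finrank ℝ E
  set c := volume.real (Metric.ball (0 : E) 1)
  have hc : 0 < c := volume_real_unit_ball_pos
  have hexponent : t ^ ((d : ℝ) / 2 + n + 1) =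
      t ^ (-((d : ℝ) / 2) * (2 * n + 1)) * t ^ ((d + 1) * (n + 1)) := by
    rw [← Real.rpow_natCast, ← Real.rpow_add ht]
    push_cast
    ring_nf
  have hconst : t ^ ((d : ℝ) / 2 + n + 1) / ((d : ℝ) / 2 + n + 1) ≤
      t ^ ((d : ℝ) / 2 + n + 1) / (n + 1) :=
    div_le_div_of_nonneg_left (by positivity) (by positivity)
      (by linarith [show 0 ≤ (d : ℝ) / 2 by positivity])
  refine le_of_mul_le_mul_left ?_ (pow_pos ht ((d + 1) * (n + 1)))
  refine (hweighted.trans (mul_le_mul_of_nonneg_left hconst (by positivity))).trans_eq ?_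
  rw [hexponent, mul_pow, pow_succ (n + 1 : ℝ)]
  field_simp

end IsMollifiedSolution

end Moments

section Supremum

open Module (finrank)

theorem measureReal_abs_ge_le {α : Type*} [MeasurableSpace α] {μ : Measure α} {f : α → ℝ} {n : ℕ}
    (hf : Integrable (fun x => |f x| ^ (n + 1)) μ) {l : ℝ} (hl : 0 < l) :
    μ.real {x | l ≤ |f x|} ≤ (∫ x, |f x| ^ (n + 1) ∂μ) / l ^ (n + 1) := by
  have hmarkov := mul_meas_ge_le_integral_of_nonneg
    (Eventually.of_forall fun x => pow_nonneg (abs_nonneg (f x)) (n + 1)) hf (l ^ (n + 1))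
  simp only [pow_le_pow_iff_left₀ hl.le (abs_nonneg _) n.succ_ne_zero] at hmarkov
  exact (le_div_iff₀' (pow_pos hl _)).2 hmarkov

theorem ae_abs_le_of_frequently_integral_pow_le {α : Type*} [MeasurableSpace α] {μ : Measure α}
    {f : α → ℝ} {B C : ℝ} (hf : ∀ n, Integrable (fun x => |f x| ^ (n + 1)) μ) (hB : 0 ≤ B)
    (hmoment : ∃ᶠ n in atTop, ∫ x, |f x| ^ (n + 1) ∂μ ≤ C * B ^ (n + 1)) :
    ∀ᵐ x ∂μ, |f x| ≤ B := by
  refine (ae_le_const_iff_forall_gt_measure_zero _ _).2 fun l hl => ?_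
  have hl0 : 0 < l := hB.trans_lt hl
  have hlim : Tendsto (fun n : ℕ => C * (B / l) ^ (n + 1)) atTop (𝓝 0) := by
    simpa using ((tendsto_pow_atTop_nhds_zero_of_lt_one (by positivity)
      ((div_lt_one hl0).2 hl)).comp (tendsto_add_atTop_nat 1)).const_mul C
  have hzero : μ.real {x | l ≤ |f x|} ≤ 0 := by
    refine ge_of_tendsto_of_frequently hlim (hmoment.mono fun n hn => ?_)
    rw [div_pow, ← mul_div_assoc]
    exact (measureReal_abs_ge_le (hf n) hl0).trans
      (div_le_div_of_nonneg_right hn (pow_nonneg hl0.le _))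
  have hfinite : μ {x | l ≤ |f x|} ≠ ⊤ := by
    simpa using ((hf 0).measure_norm_ge_lt_top hl0).ne
  exact (measureReal_eq_zero_iff hfinite).1 (le_antisymm hzero measureReal_nonneg)

/-- The constant of the `L¹`–`L^∞` decay estimate, where the Moser iteration closes. -/
noncomputable def decayConst (E : Type*) [NormedAddCommGroup E] [InnerProductSpace ℝ E]
    [FiniteDimensional ℝ E] [MeasurableSpace E] [BorelSpace E] : ℝ :=
  (finrank ℝ E + 1) ^ (finrank ℝ E + 1) / volume.real (Metric.ball (0 : E) 1) * 2 ^ finrank ℝ E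

variable {E : Type*} [NormedAddCommGroup E] [InnerProductSpace ℝ E] [FiniteDimensional ℝ E]
  [MeasurableSpace E] [BorelSpace E]

theorem decayConst_pos : 0 < decayConst E := by
  have := volume_real_unit_ball_pos (E := E)
  unfold decayConst
  positivity

namespace IsMollifiedSolution

variable {a : E} {F : ℝ → ℝ} {v : ℝ → E → ℝ} {M : ℝ} {K : NNReal}

-- Moser iteration along the exponents `n + 1 = 2 ^ j`. The denominator `(n + 1) ^ d` makes the
-- polynomial growth of the constants telescope.
theorem frequently_integral_pow_le (h : IsMollifiedSolution a F v M K) :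
    ∃ᶠ n : ℕ in atTop, ∀ s, 0 < s → ∫ x, |v s x| ^ (n + 1) ≤
      (∫ x, |v 0 x|) ^ (n + 1) * decayConst E ^ n / (n + 1 : ℝ) ^ finrank ℝ E *
        s ^ (-((finrank ℝ E : ℝ) / 2) * n) := by
  rw [frequently_atTop]
  intro j
  induction j with
  | zero => exact ⟨0, le_rfl, fun s hs => by simpa using h.integral_abs_le hs.le⟩
  | succ j ih =>
    obtain ⟨n, hn, hmoment⟩ := ih
    refine ⟨2 * n + 1, by omega, fun s hs => ?_⟩
    refine (h.integral_pow_two_mul_le n hmoment hs).trans_eq ?_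
    push_cast
    rw [show (2 * n + 1 + 1 : ℝ) = 2 * (n + 1) by ring, mul_pow, pow_succ (decayConst E)]
    nth_rewrite 3 [decayConst]
    field_simp
    ring

theorem ae_abs_le (h : IsMollifiedSolution a F v M K) {t : ℝ} (ht : 0 < t) :
    ∀ᵐ x, |v t x| ≤
      (∫ x, |v 0 x|) * (decayConst E * t ^ (-((finrank ℝ E : ℝ) / 2))) := by
  set m := ∫ x, |v 0 x|
  set γ := decayConst E * t ^ (-((finrank ℝ E : ℝ) / 2)) with hγ
  have hD := decayConst_pos (E := E)
  have hm : 0 ≤ m := integral_nonneg fun x => abs_nonneg _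
  have hγ_pos : 0 < γ := mul_pos hD (Real.rpow_pos_of_pos ht _)
  refine ae_abs_le_of_frequently_integral_pow_le (C := γ⁻¹)
    (integrable_abs_pow_succ (h.curve.integrable t) (h.curve.abs_le t)) (mul_nonneg hm hγ_pos.le)
    (h.frequently_integral_pow_le.mono fun n hn => ?_)
  have hn_pow : 1 ≤ (n + 1 : ℝ) ^ finrank ℝ E :=
    one_le_pow₀ (by linarith [n.cast_nonneg (α := ℝ)])
  calc ∫ x, |v t x| ^ (n + 1)
      ≤ m ^ (n + 1) * decayConst E ^ n / (n + 1 : ℝ) ^ finrank ℝ E *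
          t ^ (-((finrank ℝ E : ℝ) / 2) * n) := hn t ht
    _ ≤ m ^ (n + 1) * decayConst E ^ n * t ^ (-((finrank ℝ E : ℝ) / 2) * n) :=
        mul_le_mul_of_nonneg_right (div_le_self (by positivity) hn_pow) (by positivity)
    _ = m ^ (n + 1) * γ ^ n := by
        rw [hγ, mul_pow, ← Real.rpow_natCast (t ^ _), ← Real.rpow_mul ht.le, mul_assoc]
    _ = γ⁻¹ * (m * γ) ^ (n + 1) := by field_simp; ring

end IsMollifiedSolution

end Supremum

section Interpolation

variable {α : Type*} [MeasurableSpace α] {μ : Measure α} {f : α → ℝ} {p : ℝ≥0∞}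

theorem eLpNorm_le_eLpNorm_one_rpow_mul_eLpNorm_top_rpow (hf : AEStronglyMeasurable f μ)
    (hp : 1 ≤ p) :
    eLpNorm f p μ ≤ eLpNorm f 1 μ ^ (p⁻¹).toReal * eLpNorm f ⊤ μ ^ (1 - (p⁻¹).toReal) := by
  rcases eq_or_ne p ⊤ with rfl | hp_top
  · simp
  set r := p.toReal
  set S := eLpNorm f ⊤ μ
  have hr : 1 ≤ r := by simpa using ENNReal.toReal_mono hp_top hp
  have hr0 : 0 < r := by linarith
  have hpow : ∫⁻ x, ‖f x‖ₑ ^ r ∂μ ≤ eLpNorm f 1 μ * S ^ (r - 1) := by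
    calc ∫⁻ x, ‖f x‖ₑ ^ r ∂μ ≤ ∫⁻ x, ‖f x‖ₑ * S ^ (r - 1) ∂μ := by
          refine lintegral_mono_ae ?_
          filter_upwards [ae_le_eLpNormEssSup (f := f) (μ := μ)] with x hx
          rw [← eLpNorm_exponent_top] at hx
          calc ‖f x‖ₑ ^ r = ‖f x‖ₑ * ‖f x‖ₑ ^ (r - 1) := by
                conv_lhs => rw [← add_sub_cancel 1 r]
                rw [ENNReal.rpow_add_of_nonneg _ _ zero_le_one (by linarith), ENNReal.rpow_one]
            _ ≤ ‖f x‖ₑ * S ^ (r - 1) := by gcongr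
      _ = eLpNorm f 1 μ * S ^ (r - 1) := by
          rw [lintegral_mul_const'' _ hf.enorm, eLpNorm_one_eq_lintegral_enorm]
  rw [eLpNorm_eq_lintegral_rpow_enorm_toReal (one_pos.trans_le hp).ne' hp_top,
    ENNReal.toReal_inv]
  calc (∫⁻ x, ‖f x‖ₑ ^ r ∂μ) ^ (1 / r) ≤ (eLpNorm f 1 μ * S ^ (r - 1)) ^ (1 / r) := by gcongr
    _ = eLpNorm f 1 μ ^ r⁻¹ * S ^ (1 - r⁻¹) := by
      rw [ENNReal.mul_rpow_of_nonneg _ _ (by positivity), ← ENNReal.rpow_mul, one_div, sub_mul,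
        mul_inv_cancel₀ hr0.ne', one_mul]

theorem eLpNorm_le_mul_rpow_of_eLpNorm_top_le {I g : ℝ≥0∞} (hf : AEStronglyMeasurable f μ)
    (hp : 1 ≤ p) (hf_one : eLpNorm f 1 μ ≤ I) (hf_top : eLpNorm f ⊤ μ ≤ I * g) :
    eLpNorm f p μ ≤ g ^ (1 - (p⁻¹).toReal) * I := by
  have hθ : (p⁻¹).toReal ≤ 1 := by
    simpa using ENNReal.toReal_mono ENNReal.one_ne_top (ENNReal.inv_le_one.2 hp)
  have hθ' : 0 ≤ 1 - (p⁻¹).toReal := sub_nonneg.2 hθ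
  calc eLpNorm f p μ
      ≤ eLpNorm f 1 μ ^ (p⁻¹).toReal * eLpNorm f ⊤ μ ^ (1 - (p⁻¹).toReal) :=
        eLpNorm_le_eLpNorm_one_rpow_mul_eLpNorm_top_rpow hf hp
    _ ≤ I ^ (p⁻¹).toReal * (I * g) ^ (1 - (p⁻¹).toReal) := by gcongr
    _ = g ^ (1 - (p⁻¹).toReal) * I := by
        rw [ENNReal.mul_rpow_of_nonneg _ _ hθ', ← mul_assoc,
          ← ENNReal.rpow_add_of_nonneg _ _ ENNReal.toReal_nonneg hθ', add_sub_cancel,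
          ENNReal.rpow_one, mul_comm]

end Interpolation

section Reduction

theorem frequently_nhdsGT_of_ae_restrict_Ioi {P : ℝ → Prop} {b t : ℝ}
    (hP : ∀ᵐ s ∂(volume.restrict (Ioi b)), P s) (hbt : b ≤ t) : ∃ᶠ s in 𝓝[>] t, P s := by
  have hdense := Measure.dense_of_ae ((ae_restrict_iff' measurableSet_Ioi).1 hP)
  refine (nhdsGT_basis t).frequently_iff.2 fun {δ} hδ => ?_
  obtain ⟨s, hs, hPs⟩ := hdense.inter_open_nonempty _ isOpen_Ioo (nonempty_Ioo.2 hδ)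
  exact ⟨s, hs, hPs (hbt.trans_lt hs.1)⟩

theorem ae_abs_le_of_tendsto_eLpNorm_one {α ι : Type*} [MeasurableSpace α] {μ : Measure α}
    {l : Filter ι} {f : ι → α → ℝ} {g : α → ℝ} {M : ℝ} (hg : AEMeasurable g μ)
    (hf : ∃ᶠ i in l, ∀ᵐ x ∂μ, |f i x| ≤ M)
    (hlim : Tendsto (fun i => eLpNorm (f i - g) 1 μ) l (𝓝 0)) : ∀ᵐ x ∂μ, |g x| ≤ M := by
  have hexcess : ∫⁻ x, ENNReal.ofReal (|g x| - M) ∂μ ≤ 0 := by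
    refine ge_of_tendsto_of_frequently hlim (hf.mono fun i hi => ?_)
    rw [eLpNorm_one_eq_lintegral_enorm]
    refine lintegral_mono_ae ?_
    filter_upwards [hi] with x hx
    rw [Pi.sub_apply, Real.enorm_eq_ofReal_abs, abs_sub_comm]
    exact ENNReal.ofReal_le_ofReal
      ((sub_le_sub_left hx _).trans (abs_sub_abs_le_abs_sub (g x) (f i x)))
  filter_upwards [(lintegral_eq_zero_iff' (hg.abs.sub_const M).ennreal_ofReal).1
    (nonpos_iff_eq_zero.1 hexcess)] with x hx
  exact sub_nonpos.1 (ENNReal.ofReal_eq_zero.1 hx)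

namespace IsConvectionDiffusionSolution

variable {N : ℕ} {a : EuclideanSpace ℝ (Fin N)} {F : ℝ → ℝ} {u₀ : EuclideanSpace ℝ (Fin N) → ℝ}
  {u : ℝ → EuclideanSpace ℝ (Fin N) → ℝ}

theorem exists_ae_ae_abs_le (h : IsConvectionDiffusionSolution a F u₀ u) :
    ∃ M : ℝ, 0 ≤ M ∧ ∀ᵐ s ∂(volume.restrict (Ioi (0 : ℝ))), ∀ᵐ x, |u s x| ≤ M := by
  have hu := h.memLp_top
  rw [Measure.volume_eq_prod, ← Measure.prod_restrict, Measure.restrict_univ] at hu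
  set μ := (volume.restrict (Ioi (0 : ℝ))).prod (volume : Measure (EuclideanSpace ℝ (Fin N)))
  set M := (eLpNorm (Function.uncurry u) ⊤ μ).toReal
  refine ⟨M, ENNReal.toReal_nonneg, Measure.ae_ae_of_ae_prod (p := fun q => |u q.1 q.2| ≤ M) ?_⟩
  filter_upwards [ae_le_eLpNormEssSup (f := Function.uncurry u) (μ := μ)] with q hq
  simpa only [toReal_enorm, Real.norm_eq_abs, Function.uncurry] using ENNReal.toReal_mono hu.2.ne hq

theorem exists_ae_abs_le (h : IsConvectionDiffusionSolution a F u₀ u) :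
    ∃ M : ℝ, 0 ≤ M ∧ ∀ t, 0 ≤ t → ∀ᵐ x, |u t x| ≤ M := by
  obtain ⟨M, hM, hu⟩ := h.exists_ae_ae_abs_le
  exact ⟨M, hM, fun t ht => ae_abs_le_of_tendsto_eLpNorm_one (h.memLp_one t ht).1.aemeasurable
    (frequently_nhdsGT_of_ae_restrict_Ioi hu ht)
    ((h.continuous_L1 t ht).mono_left (nhdsWithin_mono t fun s hs => ht.trans hs.le))⟩

theorem exists_isBoundedL1Curve (h : IsConvectionDiffusionSolution a F u₀ u) :
    ∃ v M, IsBoundedL1Curve v M ∧ ∀ t, 0 ≤ t → v t =ᵐ[volume] u t := by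
  obtain ⟨M, hM, hu⟩ := h.exists_ae_abs_le
  have hmemLp (t : ℝ) : MemLp (u (max t 0)) 1 volume := h.memLp_one _ (le_max_right _ _)
  choose v hv_meas hv_range hv_eq using fun t => (hmemLp t).1.aemeasurable.exists_ae_eq_range_subset
    (t := Icc (-M) M) ((hu _ (le_max_right t 0)).mono fun x hx => abs_le.1 hx)
    ⟨0, neg_nonpos.2 hM, hM⟩
  have hv_int (t : ℝ) : Integrable (v t) :=
    (memLp_one_iff_integrable.1 (hmemLp t)).congr (hv_eq t)
  refine ⟨v, M, ⟨hv_meas, hv_int, fun t x => abs_le.2 (hv_range t ⟨x, rfl⟩), fun t => ?_⟩,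
    fun t ht => by simpa [max_eq_left ht] using (hv_eq t).symm⟩
  have hmax : Tendsto (fun s : ℝ => max s 0) (𝓝 t) (𝓝[Ici 0] (max t 0)) :=
    tendsto_nhdsWithin_iff.2 ⟨(continuous_id.max continuous_const).tendsto t,
      Eventually.of_forall fun s => le_max_right s 0⟩
  have hlim := (ENNReal.tendsto_toReal ENNReal.zero_ne_top).comp
    ((h.continuous_L1 (max t 0) (le_max_right _ _)).comp hmax)
  rw [ENNReal.toReal_zero] at hlim
  refine hlim.congr fun s => ?_
  simp only [Function.comp_apply]
  rw [eLpNorm_congr_ae ((hv_eq s).sub (hv_eq t)), eLpNorm_one_eq_lintegral_enorm]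
  exact (integral_norm_eq_lintegral_enorm ((hv_int s).sub (hv_int t)).aestronglyMeasurable).symm

theorem exists_isMollifiedSolution (h : IsConvectionDiffusionSolution a F u₀ u)
    (hF : LocallyLipschitz F) (hF0 : F 0 = 0) :
    ∃ v M K, IsMollifiedSolution a F v M K ∧ ∀ t, 0 ≤ t → v t =ᵐ[volume] u t := by
  obtain ⟨v, M, hv, hvu⟩ := h.exists_isBoundedL1Curve
  obtain ⟨K, hK⟩ := (hF.locallyLipschitzOn (s := Icc (-M) M)).exists_lipschitzOnWith_of_compact
    isCompact_Icc
  have hflux := hv.comp hF.continuous hF0 hK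
  refine ⟨v, M, K, ⟨hv, hF.continuous, hF0, hK, fun k hk x t ht =>
    hv.hasDerivAt_mollify hflux (fun φ hφ => ?_) hk x ht⟩, hvu⟩
  have hequation := h.equation φ hφ
  have hleft : ∀ s ∈ Ioi (0 : ℝ),
      ∫ x, v s x * (deriv (fun τ => φ τ x) s + Laplacian.laplacian (φ s) x) =
      ∫ x, u s x * (deriv (fun τ => φ τ x) s + Laplacian.laplacian (φ s) x) := fun s hs =>
    integral_congr_ae ((hvu s (le_of_lt hs)).mono fun x hx => by simp only [hx])
  have hright : ∀ s ∈ Ioi (0 : ℝ), ∫ x, F (v s x) * fderiv ℝ (φ s) x a =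
      ∫ x, F (u s x) * fderiv ℝ (φ s) x a := fun s hs =>
    integral_congr_ae ((hvu s (le_of_lt hs)).mono fun x hx => by simp only [hx])
  rwa [setIntegral_congr_fun measurableSet_Ioi hleft,
    setIntegral_congr_fun measurableSet_Ioi hright]

end IsConvectionDiffusionSolution

end Reduction

theorem IsMollifiedSolution.eLpNorm_le {E : Type*} [NormedAddCommGroup E] [InnerProductSpace ℝ E]
    [FiniteDimensional ℝ E] [MeasurableSpace E] [BorelSpace E] {a : E} {F : ℝ → ℝ} {v : ℝ → E → ℝ}
    {M : ℝ} {K : NNReal} (h : IsMollifiedSolution a F v M K) {p : ℝ≥0∞} (hp : 1 ≤ p) {t : ℝ}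
    (ht : 0 < t) :
    eLpNorm (v t) p volume ≤
      ENNReal.ofReal (decayConst E * t ^ (-((Module.finrank ℝ E : ℝ) / 2))) ^ (1 - (p⁻¹).toReal) *
        eLpNorm (v 0) 1 volume := by
  have hnorm (s : ℝ) : eLpNorm (v s) 1 volume = ENNReal.ofReal (∫ x, |v s x|) := by
    rw [eLpNorm_one_eq_lintegral_enorm]
    exact (ofReal_integral_norm_eq_lintegral_enorm (h.curve.integrable s)).symm
  refine eLpNorm_le_mul_rpow_of_eLpNorm_top_le (h.curve.measurable t).aestronglyMeasurable hp ?_ ?_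
  · rw [hnorm, hnorm]
    exact ENNReal.ofReal_le_ofReal (h.integral_abs_le ht.le)
  · rw [hnorm, ← ENNReal.ofReal_mul (integral_nonneg fun x => abs_nonneg _), eLpNorm_exponent_top]
    exact essSup_le_of_ae_le _ ((h.ae_abs_le ht).mono fun x hx =>
      (Real.enorm_eq_ofReal_abs _).trans_le (ENNReal.ofReal_le_ofReal hx))

theorem theorem4p2_general (N : ℕ) :
    ∃ C : ℝ, 0 < C ∧ ∀ p : ℝ≥0∞, 1 ≤ p →
      ∀ (a : EuclideanSpace ℝ (Fin N)) (F : ℝ → ℝ), LocallyLipschitz F → F 0 = 0 →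
      ∀ (u₀ : EuclideanSpace ℝ (Fin N) → ℝ) (u : ℝ → EuclideanSpace ℝ (Fin N) → ℝ),
      IsConvectionDiffusionSolution a F u₀ u → ∀ t : ℝ, 0 < t →
        eLpNorm (u t) p volume ≤
          ENNReal.ofReal (C * t ^ (-((N : ℝ) / 2) * (1 - (p⁻¹).toReal))) *
            eLpNorm u₀ 1 volume := by
  set D := decayConst (EuclideanSpace ℝ (Fin N))
  have hD : 0 < D := decayConst_pos
  refine ⟨max 1 D, by positivity, fun p hp a F hF hF0 u₀ u hu t ht => ?_⟩
  obtain ⟨v, M, K, hv, hvu⟩ := hu.exists_isMollifiedSolution hF hF0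
  have hdecay := hv.eLpNorm_le hp ht
  rw [finrank_euclideanSpace_fin, eLpNorm_congr_ae (hvu t ht.le),
    eLpNorm_congr_ae ((hvu 0 le_rfl).trans hu.initial)] at hdecay
  set θ := 1 - (p⁻¹).toReal
  have hθ : 0 ≤ θ := sub_nonneg.2 <| by
    simpa using ENNReal.toReal_mono ENNReal.one_ne_top (ENNReal.inv_le_one.2 hp)
  have hθ_le : θ ≤ 1 := sub_le_self _ ENNReal.toReal_nonneg
  have hconst : D ^ θ ≤ max 1 D :=
    (Real.rpow_le_rpow hD.le (le_max_right 1 D) hθ).trans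
      (Real.rpow_le_self_of_one_le (le_max_left 1 D) hθ_le)
  refine hdecay.trans (mul_le_mul_left ?_ _)
  rw [ENNReal.ofReal_rpow_of_nonneg (by positivity) hθ, Real.mul_rpow hD.le (by positivity),
    ← Real.rpow_mul ht.le]
  gcongr

theorem theorem4p2 (N : ℕ) (hN : 1 ≤ N) (p : ℝ≥0∞) (hp : 1 ≤ p) :
    ∃ C : ℝ, 0 < C ∧
      ∀ (a : EuclideanSpace ℝ (Fin N)) (F : ℝ → ℝ), ContDiff ℝ 1 F → F 0 = 0 →
      ∀ u₀ : EuclideanSpace ℝ (Fin N) → ℝ, MemLp u₀ 1 volume → MemLp u₀ ⊤ volume →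
      ∀ u : ℝ → EuclideanSpace ℝ (Fin N) → ℝ, IsConvectionDiffusionSolution a F u₀ u →
      ∀ t : ℝ, 0 < t →
        eLpNorm (u t) p volume ≤
          ENNReal.ofReal (C * t ^ (-((N : ℝ) / 2) * (1 - (p⁻¹).toReal))) *
            eLpNorm u₀ 1 volume := by
  obtain ⟨C, hC, hdecay⟩ := theorem4p2_general N
  exact ⟨C, hC, fun a F hF hF0 u₀ _ _ => hdecay p hp a F hF.locallyLipschitz hF0 u₀⟩
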